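/- Let $D$ be a connected link diagram. Let $\langle D\rangle\in\mathbb Z[A,A^{-1}]$ be its Kauffman bracket, normalized so that a single circle has bracket $1$: $$\langle D\rangle=\sum_{\sigma}A^{a(\sigma)-b(\sigma)}\,(-A^{2}-A^{-2})^{|\sigma|-1},$$ where $\sigma$ ranges over the Kauffman states of $D$ (a choice of $A$- or $B$-resolution at every crossing), $a(\sigma)$ and $b(\sigma)$ are the numbers of $A$- and $B$-resolutions in $\sigma$, and $|\sigma|$ is the number of circles of $\sigma$. Let $\mathbb G_A(D)$ be the graph of the all-$A$ state: its vertices are the circles of this state, and every crossing of $D$ gives one edge, which joins the two (possibly equal) circles that meet at the resolved crossing. Write $e$ and $v$ for its numbers of edges and vertices, and put $M(D)=e+2v-2$; no larger exponent of $A$ occurs in $\langle D\rangle$, and all exponents that occur are congruent to $M(D)$ modulo $4$. For $l\ge 0$ let $a_{M-l}(D)$ be the $(l+1)$-th coefficient of $\langle D\rangle$ counted down from the maximum possible degree, i.e. the coefficient of $A^{M(D)-4l}$. The diagram $D$ is called $A$-adequate if $\mathbb G_A(D)$ has no one-edge loops. For $n\ge 1$ let $D^n$ be the diagram obtained from $D$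 by taking $n$ parallel copies of $D$ (with the blackboard framing); $M(D^n)$ and $a_{M-l}(D^n)$ are defined in the same way from $D^n$. **Lemma.** Suppose that $a_M(D)\neq 0$ and that $D$ is not $A$-adequate. Then $a_{M-1}(D^n)=0$ for all $n>2$; that is, the coefficient of $A^{M(D^n)-4}$ in $\langle D^n\rangle$ is $0$. -/

import Mathlib

/-- A link diagram with crossing set `X`, as a combinatorial map (a PD code).

The four half-edges at a crossing `x` are `(x, 0), (x, 1), (x, 2), (x, 3)`, in counterclockwise
order, where `0` and `2` belong to the understrand and `1` and `3` to the overstrand; so a crossing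
may be drawn with `0, 1, 2, 3` pointing south, east, north, west. The involution `glue` matches the
two half-edges of every edge. Components of the diagram without any crossing are not seen by the
half-edges; `freeCircles` is their number. No planarity is built in: see `LinkDiagram.IsPlanar`. -/
structure LinkDiagram (X : Type*) where
  glue : X × Fin 4 → X × Fin 4
  glue_glue : ∀ d, glue (glue d) = d
  glue_ne : ∀ d, glue d ≠ d
  freeCircles : ℕ

/-- The two ways to resolve a crossing. -/
inductive Smoothing where
  | A
  | B
  deriving DecidableEq

instance : Fintype Smoothing := ⟨{.A, .B}, by rintro (_ | _) <;> simp⟩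

/-- How a resolution reconnects the four half-edges of a crossing. The `A`-resolution merges the two
regions that the overstrand sweeps out when it is turned counterclockwise (those between `1` and `2`
and between `3` and `0`), so it joins `0` to `1` and `2` to `3`; the `B`-resolution is the other. -/
def Smoothing.join : Smoothing → Fin 4 → Fin 4
  | .A => ![1, 0, 3, 2]
  | .B => ![3, 2, 1, 0]

/-- The exponent of `A` contributed to the Kauffman bracket by a resolved crossing. -/
def Smoothing.sign : Smoothing → ℤ
  | .A => 1
  | .B => -1

namespace LinkDiagram

variable {X : Type*}

/-! ### Connectedness and planarity -/

/-- Connected components of the underlying projection that contain a crossing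
(`Quot` divides by the equivalence relation that is generated by the given one). -/
def CrossingComponent (D : LinkDiagram X) : Type _ :=
  Quot (fun d e : X × Fin 4 => e = D.glue d ∨ e.1 = d.1)

/-- The underlying projection is connected (and nonempty). -/
def IsConnected (D : LinkDiagram X) : Prop :=
  Nat.card D.CrossingComponent + D.freeCircles = 1

/-- Faces of the combinatorial map: go along the edge, then turn to the next half-edge. -/
def Face (D : LinkDiagram X) : Type _ :=
  Quot (fun d e : X × Fin 4 => e = ((D.glue d).1, (D.glue d).2 + 1))

/-- The diagram is drawn in the plane (equivalently, in the sphere): its 4-valent graph, with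
`|X|` vertices and `2|X|` edges, satisfies Euler's formula `V - E + F = 2 k` for the cellular
embedding of its `k` components given by the counterclockwise order of the half-edges. -/
def IsPlanar [Fintype X] (D : LinkDiagram X) : Prop :=
  (Fintype.card X : ℤ) - 2 * Fintype.card X + Nat.card D.Face = 2 * Nat.card D.CrossingComponent

/-! ### Kauffman states and the Kauffman bracket -/

/-- The circles of the state `s`. -/
def StateCircle (D : LinkDiagram X) (s : X → Smoothing) : Type _ :=
  Quot (fun d e : X × Fin 4 => e = D.glue d ∨ e = (d.1, (s d.1).join d.2)) ⊕ Fin D.freeCircles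

/-- The circle of the state `s` that runs through the half-edge `d`. -/
def circleAt (D : LinkDiagram X) (s : X → Smoothing) (d : X × Fin 4) : D.StateCircle s :=
  Sum.inl (Quot.mk _ d)

/-- The number of circles of the state `s`. -/
noncomputable def numCircles (D : LinkDiagram X) (s : X → Smoothing) : ℕ :=
  Nat.card (D.StateCircle s)

/-- The graph of the state `s` has the circles of `s` as its vertices and one edge for each crossing
`x`. This is the pair of end points of that edge: the circles through the two arcs that replace the
crossing (for both resolutions, one arc contains the half-edge `0` and the other one `2`). -/
def edgeEnds (D : LinkDiagram X) (s : X → Smoothing) (x : X) : Sym2 (D.StateCircle s) :=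
  s(D.circleAt s (x, 0), D.circleAt s (x, 2))

/-- The all-`A` state. -/
def allA : X → Smoothing := fun _ => Smoothing.A

/-- The graph of the all-`A` state has no one-edge loop. -/
def IsAAdequate (D : LinkDiagram X) : Prop :=
  ∀ x : X, ¬ (D.edgeEnds allA x).IsDiag

/-- The Kauffman bracket in `ℤ[A, A⁻¹]`, with `T k` standing for `A ^ k`, as the sum over all states;
the bracket of a single circle is `1`. -/
noncomputable def bracket [Fintype X] [DecidableEq X] (D : LinkDiagram X) : LaurentPolynomial ℤ :=
  ∑ s : X → Smoothing, LaurentPolynomial.T (∑ x, (s x).sign) *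
    (-LaurentPolynomial.T 2 - LaurentPolynomial.T (-2)) ^ (D.numCircles s - 1)

/-- `M(D) = e + 2 v - 2` for the graph of the all-`A` state, with `e` edges and `v` vertices: the
largest exponent of `A` that can possibly occur in the bracket. -/
noncomputable def maxDegree [Fintype X] (D : LinkDiagram X) : ℤ :=
  Fintype.card X + 2 * D.numCircles allA - 2

/-- `a_{M-l}(D)`: the `(l+1)`-th coefficient of the bracket, counted down from the exponent `M(D)`.
The exponents of `A` in the bracket are all congruent modulo `4`, so successive coefficients belong
to the exponents `M(D), M(D) - 4, M(D) - 8, …`. -/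
noncomputable def topCoeff [Fintype X] [DecidableEq X] (D : LinkDiagram X) (l : ℕ) : ℤ :=
  D.bracket.coeff (D.maxDegree - 4 * l)

/-! ### Parallels

In `D ^ n` a crossing `x` of `D` becomes an `n × n` grid of crossings `(x, j, k)`, where `j` is the row
(counted from south to north) and `k` the column (from west to east). -/

/-- The half-edges that leave the grid of a crossing of `D` in place of the half-edge `d` of `D`;
`p` is the position among these `n` half-edges, counted counterclockwise around the crossing. -/
def outer {n : ℕ} (d : X × Fin 4) (p : Fin n) : (X × Fin n × Fin n) × Fin 4 :=
  match d with
  | (x, 0) => ((x, ⟨0, p.pos⟩, p), 0)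
  | (x, 1) => ((x, p, Fin.rev ⟨0, p.pos⟩), 1)
  | (x, 2) => ((x, Fin.rev ⟨0, p.pos⟩, Fin.rev p), 2)
  | (x, 3) => ((x, Fin.rev p, ⟨0, p.pos⟩), 3)

/-- The gluing of the half-edges of `D ^ n`. Inside a grid, neighbours are connected. Between grids,
the `n` half-edges that replace a half-edge `d` are connected to those that replace `D.glue d`, by
parallel strands; so the counterclockwise positions at the two ends are opposite. -/
def parallelGlue (D : LinkDiagram X) (n : ℕ) :
    (X × Fin n × Fin n) × Fin 4 → (X × Fin n × Fin n) × Fin 4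
  | ((x, j, k), 0) =>
    if (j : ℕ) = 0 then outer (D.glue (x, 0)) (Fin.rev k)
    else ((x, ⟨j - 1, by omega⟩, k), 2)
  | ((x, j, k), 1) =>
    if h : (k : ℕ) + 1 = n then outer (D.glue (x, 1)) (Fin.rev j)
    else ((x, j, ⟨k + 1, by omega⟩), 3)
  | ((x, j, k), 2) =>
    if h : (j : ℕ) + 1 = n then outer (D.glue (x, 2)) k
    else ((x, ⟨j + 1, by omega⟩, k), 0)
  | ((x, j, k), 3) =>
    if (k : ℕ) = 0 then outer (D.glue (x, 3)) j
    else ((x, j, ⟨k - 1, by omega⟩), 1)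

theorem parallelGlue_outer (D : LinkDiagram X) (n : ℕ) (d : X × Fin 4) (p : Fin n) :
    D.parallelGlue n (outer d p) = outer (D.glue d) (Fin.rev p) := by
  obtain ⟨x, i⟩ := d
  have hp := p.pos
  fin_cases i
  · simp [outer, parallelGlue]
  · have h : n - (0 + 1) + 1 = n := by omega
    simp [outer, parallelGlue, Fin.val_rev]
    omega
  · have h : n - (0 + 1) + 1 = n := by omega
    simp [outer, parallelGlue, Fin.val_rev]
    omega
  · simp [outer, parallelGlue]

theorem outer_ne {n : ℕ} {d e : X × Fin 4} (h : d ≠ e) (p q : Fin n) : outer d p ≠ outer e q := by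
  obtain ⟨x, i⟩ := d
  obtain ⟨y, j⟩ := e
  intro h'
  apply h
  fin_cases i <;> fin_cases j <;> simp_all [outer]

/-- A half-edge of `D ^ n` either leaves its grid or is glued to a neighbour inside the grid. -/
theorem eq_outer_or (D : LinkDiagram X) (n : ℕ) (h : (X × Fin n × Fin n) × Fin 4) :
    (∃ d p, h = outer d p) ∨
      (D.parallelGlue n (D.parallelGlue n h) = h ∧ D.parallelGlue n h ≠ h) := by
  obtain ⟨⟨x, j, k⟩, i⟩ := h
  have hj := j.isLt
  have hk := k.isLt
  fin_cases i
  · by_cases h0 : (j : ℕ) = 0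
    · exact Or.inl ⟨(x, 0), k, by simp [outer, Fin.ext_iff, h0]⟩
    · right
      have h1 : (j : ℕ) - 1 + 1 = j := by omega
      have h2 : (j : ℕ) ≠ n := by omega
      simp [parallelGlue, h0, h1, h2]
  · by_cases h0 : (k : ℕ) + 1 = n
    · refine Or.inl ⟨(x, 1), j, ?_⟩
      simp [outer, Fin.ext_iff, Fin.val_rev]
      omega
    · right
      simp [parallelGlue, h0]
  · by_cases h0 : (j : ℕ) + 1 = n
    · refine Or.inl ⟨(x, 2), Fin.rev k, ?_⟩
      simp [outer, Fin.ext_iff, Fin.val_rev]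
      omega
    · right
      simp [parallelGlue, h0]
  · by_cases h0 : (k : ℕ) = 0
    · exact Or.inl ⟨(x, 3), Fin.rev j, by simp [outer, Fin.ext_iff, h0]⟩
    · right
      have h1 : (k : ℕ) - 1 + 1 = k := by omega
      have h2 : (k : ℕ) ≠ n := by omega
      simp [parallelGlue, h0, h1, h2]

/-- The `n`-parallel `D ^ n` of `D` (with respect to the blackboard framing). -/
def parallel (D : LinkDiagram X) (n : ℕ) : LinkDiagram (X × Fin n × Fin n) where
  glue := D.parallelGlue n
  glue_glue h := by
    rcases D.eq_outer_or n h with ⟨d, p, rfl⟩ | h'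
    · simp [parallelGlue_outer, D.glue_glue]
    · exact h'.1
  glue_ne h := by
    rcases D.eq_outer_or n h with ⟨d, p, rfl⟩ | h'
    · rw [parallelGlue_outer]
      exact outer_ne (D.glue_ne d) _ _
    · exact h'.2
  freeCircles := n * D.freeCircles

end LinkDiagram

/-! Let `v` be the number of circles of the all-`A` state. Give a state `σ` with `b` `B`-resolutions
the defect `v + b - |σ|`. Switching a crossing from `A` to `B` creates at most one circle, so the
defect is nonnegative and monotone in the set of `B`-resolutions. A state contributes only to the
exponent `M - 2 * defect` and to every fourth one below it. Hence `a_M` is a signed count of the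
states of defect `0`, and `a_{M-1}` sees only the states of defect `0`, weighted by `|σ| - 1`, and
those of defect `2` (`topCoeff_zero_eq`, `topCoeff_one_eq`).

Suppose a loop `ℓ` of the all-`A` graph is interlaced with no other loop of its circle `S`. If no
`B`-resolution connects `S` to the rest, then toggling `ℓ` splits or merges one circle, which
preserves the defect and reverses the sign; all other states have defect at least `2`. So `a_M = 0`
(`IsLoopCut.topCoeff_zero`). Given two such loops on circles that are distinct and not adjacent, the
two commuting toggles arrange the states in fours whose contributions to `a_{M-1}` cancel
(`IsLoopCut.topCoeff_one`).

If `D` is not `A`-adequate, it has a loop `x`, and `a_M ≠ 0` forces a loop `y` interlaced with `x`.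
By planarity, interlaced loops lie on opposite sides of their circle
(`IsCheckerboard.ne_of_interlaced`). In `D ^ n` this circle becomes `n` parallel copies; `x` and `y`
yield loops on the two outermost ones. Neither is interlaced with another loop there, since that
would come from interlaced loops of `D` on the same side. For `n ≥ 3` the two outermost copies are
not adjacent, so `a_{M-1}(D ^ n) = 0`. -/

namespace LinkDiagram

variable {X : Type*}

/-! ### Circles of a state as a quotient of the half-edges -/

/-- A function on half-edges that is constant along the circles of the state `s`. -/
structure IsStateInvariant (D : LinkDiagram X) (s : X → Smoothing) {β : Type*}
    (f : X × Fin 4 → β) : Prop where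
  glue : ∀ d, f (D.glue d) = f d
  join : ∀ x i, f (x, (s x).join i) = f (x, i)

/-- The circles of the state `s` that pass through crossings. -/
def Strand (D : LinkDiagram X) (s : X → Smoothing) : Type _ :=
  Quot (fun d e : X × Fin 4 => e = D.glue d ∨ e = (d.1, (s d.1).join d.2))

/-- The strand through a half-edge. -/
def strandAt (D : LinkDiagram X) (s : X → Smoothing) (d : X × Fin 4) : D.Strand s :=
  Quot.mk _ d

theorem strandAt_surjective (D : LinkDiagram X) (s : X → Smoothing) :
    Function.Surjective (D.strandAt s) := Quot.mk_surjective

theorem strandAt_invariant (D : LinkDiagram X) (s : X → Smoothing) :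
    D.IsStateInvariant s (D.strandAt s) where
  glue _ := (Quot.sound (r := fun d e : X × Fin 4 =>
    e = D.glue d ∨ e = (d.1, (s d.1).join d.2)) (Or.inl rfl)).symm
  join x i := (Quot.sound (r := fun d e : X × Fin 4 =>
    e = D.glue d ∨ e = (d.1, (s d.1).join d.2)) (a := (x, i)) (Or.inr rfl)).symm

/-- Universal property of the quotient. Its contrapositive is how circles are shown to differ: it
suffices to find an invariant function that separates them. -/
theorem IsStateInvariant.eq_of_strandAt_eq {D : LinkDiagram X} {s : X → Smoothing} {β : Type*}
    {f : X × Fin 4 → β} (hf : D.IsStateInvariant s f) {d e : X × Fin 4}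
    (h : D.strandAt s d = D.strandAt s e) : f d = f e := by
  have := congrArg (Quot.lift f (by
    rintro a b (rfl | rfl)
    · exact (hf.glue a).symm
    · exact (hf.join a.1 a.2).symm)) h
  exact this

instance [Finite X] (D : LinkDiagram X) (s : X → Smoothing) : Finite (D.Strand s) :=
  Finite.of_surjective _ (D.strandAt_surjective s)

theorem numCircles_eq [Finite X] (D : LinkDiagram X) (s : X → Smoothing) :
    D.numCircles s = Nat.card (D.Strand s) + D.freeCircles := by
  have : D.StateCircle s = (D.Strand s ⊕ Fin D.freeCircles) := rfl
  rw [numCircles, this, Nat.card_sum, Nat.card_fin]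

theorem numCircles_pos [Finite X] [Nonempty X] (D : LinkDiagram X) (s : X → Smoothing) :
    0 < D.numCircles s := by
  rw [numCircles_eq]
  have : Nonempty (D.Strand s) := ⟨D.strandAt s (Classical.arbitrary X, 0)⟩
  have := Nat.card_pos (α := D.Strand s)
  omega

theorem Smoothing.eq_A_or_eq_B (a : Smoothing) : a = .A ∨ a = .B := by
  cases a <;> simp

theorem join_join (a : Smoothing) (i : Fin 4) : a.join (a.join i) = i := by
  cases a <;> fin_cases i <;> rfl

theorem join_ne (a : Smoothing) (i : Fin 4) : a.join i ≠ i := by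
  cases a <;> fin_cases i <;> simp [Smoothing.join]

/-! ### Changing a single resolution -/

/-- An even set argument: a finite set of half-edges that is closed under the gluing, and under the
joins of `s` with a single exception, does not exist. -/
theorem not_closed_off_one [Finite X] (D : LinkDiagram X) (s : X → Smoothing)
    (K : Set (X × Fin 4)) (d₀ : X × Fin 4) (h₀ : d₀ ∈ K) (hglue : ∀ d ∈ K, D.glue d ∈ K)
    (hjoin : ∀ d ∈ K, d ≠ d₀ → (d.1, (s d.1).join d.2) ∈ K ∧ (d.1, (s d.1).join d.2) ≠ d₀) :
    False := by
  classical
  have := Fintype.ofFinite X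
  -- The gluing pairs up all of `K`, while the joins pair up `K` without `d₀`; so `|K|` and `|K| -
  -- 1` would both be even.
  have h1 : ∑ d ∈ K.toFinset, (1 : ZMod 2) = 0 :=
    Finset.sum_involution (fun d _ => D.glue d) (fun _ _ => by decide)
      (fun d _ _ => D.glue_ne d) (fun d hd => by simpa using hglue d (by simpa using hd))
      (fun d _ => D.glue_glue d)
  have h2 : ∑ d ∈ K.toFinset.erase d₀, (1 : ZMod 2) = 0 :=
    Finset.sum_involution (fun d _ => (d.1, (s d.1).join d.2)) (fun _ _ => by decide)
      (fun d _ _ h => join_ne (s d.1) d.2 (congrArg Prod.snd h))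
      (fun d hd => by
        simp only [Finset.mem_erase, Set.mem_toFinset] at hd ⊢
        exact ⟨(hjoin d hd.2 hd.1).2, (hjoin d hd.2 hd.1).1⟩)
      (fun d _ => by simp [join_join])
  rw [← Finset.add_sum_erase _ _ (Set.mem_toFinset.2 h₀), h2] at h1
  simp at h1

/-- If the two arcs of `s` at `x` lie on different circles, then changing the resolution of `x`
connects them. -/
theorem strandAt_eq_of_ne [Finite X] (D : LinkDiagram X) {s s' : X → Smoothing} {x : X}
    (hs : ∀ y, y ≠ x → s' y = s y) (hx : s' x ≠ s x)
    (h : D.strandAt s (x, 0) ≠ D.strandAt s (x, 2)) :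
    D.strandAt s' (x, 0) = D.strandAt s' (x, 2) := by
  by_contra h'
  have I := D.strandAt_invariant s
  have I' := D.strandAt_invariant s'
  -- If `s'` did not connect the arcs, then `(x, 0)` would be the only end of `x` in the
  -- intersection of its `s`-circle with its `s'`-circle. Away from `x` the two states agree, so
  -- this intersection contradicts the parity argument.
  have key : ∀ i : Fin 4, i ≠ 0 → ¬ (D.strandAt s (x, i) = D.strandAt s (x, 0) ∧
      D.strandAt s' (x, i) = D.strandAt s' (x, 0)) := by
    intro i hi ⟨e1, e2⟩
    have j2 := I.join x 2
    have j2' := I'.join x 2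
    fin_cases i
    · exact hi rfl
    · rcases Smoothing.eq_A_or_eq_B (s x) with a | a <;>
        rcases Smoothing.eq_A_or_eq_B (s' x) with b | b <;>
        simp_all [Smoothing.join]
    · exact h e1.symm
    · rcases Smoothing.eq_A_or_eq_B (s x) with a | a <;>
        rcases Smoothing.eq_A_or_eq_B (s' x) with b | b <;>
        simp_all [Smoothing.join]
  refine D.not_closed_off_one s {d | D.strandAt s d = D.strandAt s (x, 0) ∧
      D.strandAt s' d = D.strandAt s' (x, 0)} (x, 0) ⟨rfl, rfl⟩ ?_ ?_
  · rintro d ⟨e1, e2⟩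
    exact ⟨by rw [I.glue, e1], by rw [I'.glue, e2]⟩
  · rintro ⟨y, i⟩ ⟨e1, e2⟩ hd
    by_cases hy : y = x
    · subst hy
      exact (key i (by rintro rfl; exact hd rfl) ⟨e1, e2⟩).elim
    · refine ⟨⟨by rw [I.join, e1], ?_⟩, fun e => hy (congrArg Prod.fst e)⟩
      have := I'.join y i
      rw [hs y hy] at this
      change D.strandAt s' (y, (s y).join i) = _
      rw [this, e2]

/-- If all four ends of `x` lie on one circle of `s'`, then `s'`-circles are unions of
`s`-circles. -/
theorem strandAt_invariant_of_eq (D : LinkDiagram X) {s s' : X → Smoothing} {x : X}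
    (hs : ∀ y, y ≠ x → s' y = s y) (h : D.strandAt s' (x, 0) = D.strandAt s' (x, 2)) :
    D.IsStateInvariant s (D.strandAt s') where
  glue := (D.strandAt_invariant s').glue
  join y i := by
    have I' := D.strandAt_invariant s'
    by_cases hy : y = x
    · subst hy
      have all : ∀ k : Fin 4, D.strandAt s' (y, k) = D.strandAt s' (y, 0) := by
        intro k
        have j0 := I'.join y 0
        have j2 := I'.join y 2
        rcases Smoothing.eq_A_or_eq_B (s' y) with b | b <;> rw [b] at j0 j2 <;>
          fin_cases k <;> simp_all [Smoothing.join]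
      rw [all, all i]
    · rw [← hs y hy, I'.join]

/-- Changing a resolution whose two arcs lie on different circles merges these. -/
theorem card_strand_of_ne [Finite X] (D : LinkDiagram X) {s s' : X → Smoothing} {x : X}
    (hs : ∀ y, y ≠ x → s' y = s y) (hx : s' x ≠ s x)
    (h : D.strandAt s (x, 0) ≠ D.strandAt s (x, 2)) :
    Nat.card (D.Strand s) = Nat.card (D.Strand s') + 1 := by
  classical
  have h' := D.strandAt_eq_of_ne hs hx h
  have I := D.strandAt_invariant s
  set b := D.strandAt s (x, 2) with hb
  -- `φ` identifies the two circles at `x` and thereby becomes invariant under `s'`. The circles of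
  -- `s` other than `b` then represent each circle of `s'` exactly once.
  let φ : D.Strand s → D.Strand s := fun q => if q = b then D.strandAt s (x, 0) else q
  have hφ : D.IsStateInvariant s' (fun d => φ (D.strandAt s d)) := by
    refine ⟨fun d => by simp only [I.glue], fun y i => ?_⟩
    by_cases hy : y = x
    · subst hy
      have all : ∀ k : Fin 4, φ (D.strandAt s (y, k)) = D.strandAt s (y, 0) := by
        intro k
        have j0 := I.join y 0
        have j2 := I.join y 2
        rcases Smoothing.eq_A_or_eq_B (s y) with b | b <;> rw [b] at j0 j2 <;>
          fin_cases k <;> simp_all [Smoothing.join, φ]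
      rw [all, all]
    · rw [hs y hy, I.join]
  let F : {q : D.Strand s // q ≠ b} → D.Strand s' := fun q => D.strandAt s' (q.1.out)
  have out_eq : ∀ q : D.Strand s, D.strandAt s q.out = q := fun q => Quot.out_eq q
  have hF : Function.Bijective F := by
    constructor
    · rintro ⟨q, hq⟩ ⟨r, hr⟩ e
      have := hφ.eq_of_strandAt_eq e
      simp only [out_eq, φ, hq, hr, if_false] at this
      exact Subtype.ext this
    · intro q
      obtain ⟨d, rfl⟩ := D.strandAt_surjective s' q
      have J := D.strandAt_invariant_of_eq hs h'
      by_cases hd : D.strandAt s d = b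
      · refine ⟨⟨D.strandAt s (x, 0), h⟩, ?_⟩
        have e1 : D.strandAt s' d = D.strandAt s' (x, 2) := J.eq_of_strandAt_eq hd
        rw [e1, ← h']
        exact J.eq_of_strandAt_eq (out_eq _)
      · exact ⟨⟨D.strandAt s d, hd⟩, J.eq_of_strandAt_eq (out_eq _)⟩
  rw [← Nat.card_eq_of_bijective F hF]
  rw [← Finite.card_option, Nat.card_congr (Equiv.optionSubtypeNe b)]

theorem numCircles_of_ne [Finite X] (D : LinkDiagram X) {s s' : X → Smoothing} {x : X}
    (hs : ∀ y, y ≠ x → s' y = s y) (hx : s' x ≠ s x)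
    (h : D.strandAt s (x, 0) ≠ D.strandAt s (x, 2)) :
    D.numCircles s = D.numCircles s' + 1 := by
  have := D.card_strand_of_ne hs hx h
  simp only [numCircles_eq]
  omega

theorem numCircles_of_invariant [Finite X] (D : LinkDiagram X) {s s' : X → Smoothing} {x : X}
    (hs : ∀ y, y ≠ x → s' y = s y) (hx : s' x ≠ s x) {β : Type*} {f : X × Fin 4 → β}
    (hf : D.IsStateInvariant s f) (h : f (x, 0) ≠ f (x, 2)) :
    D.numCircles s = D.numCircles s' + 1 :=
  D.numCircles_of_ne hs hx fun e => h (hf.eq_of_strandAt_eq e)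

/-- Changing one resolution raises the number of circles by at most one. -/
theorem numCircles_le_add_one [Finite X] (D : LinkDiagram X) {s s' : X → Smoothing} {x : X}
    (hs : ∀ y, y ≠ x → s' y = s y) : D.numCircles s' ≤ D.numCircles s + 1 := by
  by_cases hx : s' x = s x
  · have : s' = s := by
      funext y
      by_cases hy : y = x
      · rw [hy, hx]
      · exact hs y hy
    rw [this]
    omega
  by_cases h' : D.strandAt s' (x, 0) = D.strandAt s' (x, 2)
  · have J := D.strandAt_invariant_of_eq hs h'
    have : Nat.card (D.Strand s') ≤ Nat.card (D.Strand s) := by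
      refine Nat.card_le_card_of_surjective (fun q : D.Strand s => D.strandAt s' q.out) ?_
      intro q
      obtain ⟨d, rfl⟩ := D.strandAt_surjective s' q
      exact ⟨D.strandAt s d, J.eq_of_strandAt_eq (Quot.out_eq _)⟩
    simp only [numCircles_eq]
    omega
  · exact (D.numCircles_of_ne (fun y hy => (hs y hy).symm) (Ne.symm hx) h').le

section

/-! ### Coefficients of the bracket -/

open LaurentPolynomial in
-- Binomial expansion. Consecutive exponents differ by `4`, so each coefficient needed below is one
-- signed binomial coefficient or zero.
theorem coeff_loop_value_pow (m : ℕ) (t : ℤ) :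
    (((-T 2 - T (-2)) ^ m : LaurentPolynomial ℤ)).coeff t =
      (-1) ^ m * ∑ k ∈ Finset.range (m + 1), if 4 * (k : ℤ) - 2 * m = t then (m.choose k : ℤ) else 0 := by
  have h : (-T 2 - T (-2) : LaurentPolynomial ℤ) = C (-1) * (T 2 + T (-2)) := by
    simp; ring
  rw [h, mul_pow, ← map_pow, add_pow, ← smul_eq_C_mul, AddMonoidAlgebra.coeff_smul,
    Finsupp.smul_apply, AddMonoidAlgebra.coeff_sum, Finsupp.finsetSum_apply, smul_eq_mul]
  congr 1
  refine Finset.sum_congr rfl fun k hk => ?_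
  have hk' : k ≤ m := by simpa [Nat.lt_succ_iff] using hk
  have : (T 2 ^ k * T (-2) ^ (m - k) * (m.choose k : LaurentPolynomial ℤ)) =
      (m.choose k : ℤ) • T (4 * (k : ℤ) - 2 * m) := by
    rw [T_pow, T_pow, ← T_add, zsmul_eq_mul, mul_comm]
    push_cast [hk']
    congr 2
    ring
  rw [this, AddMonoidAlgebra.coeff_smul, Finsupp.smul_apply, T_apply]
  simp

theorem coeff_loop_value_pow_of_lt {m : ℕ} {t : ℤ} (h : 2 * (m : ℤ) < t) :
    (((-LaurentPolynomial.T 2 - LaurentPolynomial.T (-2)) ^ m : LaurentPolynomial ℤ)).coeff t = 0 := by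
  rw [coeff_loop_value_pow, Finset.sum_eq_zero, mul_zero]
  intro k hk
  have hk' : k ≤ m := by simpa [Nat.lt_succ_iff] using hk
  rw [if_neg (by omega)]

theorem coeff_loop_value_pow_of_odd {m : ℕ} {t : ℤ} (h : 2 * (m : ℤ) - 2 = t) :
    (((-LaurentPolynomial.T 2 - LaurentPolynomial.T (-2)) ^ m : LaurentPolynomial ℤ)).coeff t = 0 := by
  rw [coeff_loop_value_pow, Finset.sum_eq_zero, mul_zero]
  intro k hk
  rw [if_neg (by omega)]

theorem coeff_loop_value_pow_top {m : ℕ} {t : ℤ} (h : 2 * (m : ℤ) = t) :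
    (((-LaurentPolynomial.T 2 - LaurentPolynomial.T (-2)) ^ m : LaurentPolynomial ℤ)).coeff t =
      (-1) ^ m := by
  rw [coeff_loop_value_pow, Finset.sum_eq_single m]
  · rw [if_pos (by omega)]
    simp
  · intro k _ hk
    rw [if_neg (by omega)]
  · simp

theorem coeff_loop_value_pow_second {m : ℕ} {t : ℤ} (h : 2 * (m : ℤ) - 4 = t) :
    (((-LaurentPolynomial.T 2 - LaurentPolynomial.T (-2)) ^ m : LaurentPolynomial ℤ)).coeff t =
      (-1) ^ m * m := by
  rw [coeff_loop_value_pow]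
  rcases m with _ | m
  · rw [Finset.sum_eq_zero]
    · simp
    · intro k _
      rw [if_neg (by omega)]
  · rw [Finset.sum_eq_single m]
    · rw [if_pos (by omega), Nat.choose_succ_self_right]
    · intro k _ hk
      rw [if_neg (by omega)]
    · simp

/-! ### The defect and the two leading coefficients -/

variable [Fintype X]

/-- The number of `B`-resolutions. -/
def numB (s : X → Smoothing) : ℕ := (Finset.univ.filter fun x => s x = .B).card

/-- How much the number of circles of `s` falls short of its largest conceivable value. -/
noncomputable def defect (D : LinkDiagram X) (s : X → Smoothing) : ℤ :=
  D.numCircles allA + numB s - D.numCircles s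

theorem sum_sign (s : X → Smoothing) : ∑ x, (s x).sign = (Fintype.card X : ℤ) - 2 * numB s := by
  have : ∀ x, (s x).sign = 1 - 2 * (if s x = .B then 1 else 0) := by
    intro x
    cases s x <;> simp [Smoothing.sign]
  simp only [this, Finset.sum_sub_distrib, ← Finset.mul_sum, Finset.sum_boole, numB]
  simp

theorem topCoeff_eq [DecidableEq X] (D : LinkDiagram X) (l : ℕ) : D.topCoeff l = ∑ s : X → Smoothing,
    (((-LaurentPolynomial.T 2 - LaurentPolynomial.T (-2)) ^ (D.numCircles s - 1) :
      LaurentPolynomial ℤ)).coeff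
      (D.maxDegree - 4 * l - ((Fintype.card X : ℤ) - 2 * numB s)) := by
  rw [topCoeff, bracket, AddMonoidAlgebra.coeff_sum, Finsupp.finsetSum_apply]
  refine Finset.sum_congr rfl fun s _ => ?_
  rw [← sum_sign, LaurentPolynomial.T, AddMonoidAlgebra.coeff_single_mul_apply]
  simp only [one_mul]
  congr 1
  ring

theorem defect_allA (D : LinkDiagram X) : D.defect allA = 0 := by
  simp [defect, numB, allA]

theorem numB_update [DecidableEq X] {s : X → Smoothing} {x : X} (hx : s x = .A) :
    numB (Function.update s x .B) = numB s + 1 := by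
  rw [numB, numB, ← Finset.card_insert_of_notMem (a := x) (by simp [hx])]
  congr 1
  ext y
  by_cases hy : y = x
  · subst hy; simp
  · simp [hy]

theorem defect_le_update [DecidableEq X] (D : LinkDiagram X) {s : X → Smoothing} {x : X}
    (hx : s x = .A) : D.defect s ≤ D.defect (Function.update s x .B) := by
  have h := D.numCircles_le_add_one (s := s) (s' := Function.update s x .B) (x := x)
    (fun y hy => Function.update_of_ne hy _ _)
  rw [defect, defect, numB_update hx]
  push_cast
  omega

theorem defect_update_A_le [DecidableEq X] (D : LinkDiagram X) (s : X → Smoothing) (x : X) :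
    D.defect (Function.update s x .A) ≤ D.defect s := by
  rcases Smoothing.eq_A_or_eq_B (s x) with h | h
  · rw [← h, Function.update_eq_self]
  · refine (D.defect_le_update (x := x) (by simp)).trans_eq ?_
    rw [Function.update_idem, ← h, Function.update_eq_self]

/-- The defect is monotone in the set of crossings with a `B`-resolution. -/
theorem defect_reset_le [DecidableEq X] (D : LinkDiagram X) (s : X → Smoothing) (F : Finset X) :
    D.defect (fun x => if x ∈ F then .A else s x) ≤ D.defect s := by
  induction F using Finset.induction_on with
  | empty => simp
  | insert a F _ ih =>
    refine le_trans (le_of_eq ?_) ((D.defect_update_A_le _ a).trans ih)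
    congr 1
    funext x
    by_cases hx : x = a
    · subst hx; simp
    · simp [hx]

theorem defect_nonneg [DecidableEq X] (D : LinkDiagram X) (s : X → Smoothing) :
    0 ≤ D.defect s := by
  have h := D.defect_reset_le s Finset.univ
  simp only [Finset.mem_univ, if_true] at h
  exact (D.defect_allA).symm.trans_le h

/-- The largest exponent in the term of `s` is `M - 2 * defect`. Positivity of `numCircles` makes
the truncated subtraction harmless. -/
theorem topCoeff_zero_eq [DecidableEq X] [Nonempty X] (D : LinkDiagram X) :
    D.topCoeff 0 = ∑ s : X → Smoothing,
      if D.defect s = 0 then (-1) ^ (D.numCircles s - 1) else 0 := by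
  rw [topCoeff_eq]
  refine Finset.sum_congr rfl fun s _ => ?_
  have h0 := D.defect_nonneg s
  have h1 := D.numCircles_pos s
  rw [maxDegree]
  rw [defect] at h0 ⊢
  push_cast
  split_ifs with h
  · exact coeff_loop_value_pow_top (by omega)
  · exact coeff_loop_value_pow_of_lt (by omega)

/-- At exponent `M - 4`, a state of defect `0` contributes its second coefficient, which brings the
factor `|s| - 1`, and one of defect `2` its leading one. For defect `1` the exponent falls into a
gap of the expansion. -/
theorem topCoeff_one_eq [DecidableEq X] [Nonempty X] (D : LinkDiagram X) :
    D.topCoeff 1 = ∑ s : X → Smoothing,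
      ((if D.defect s = 0 then (-1) ^ (D.numCircles s - 1) * ((D.numCircles s : ℤ) - 1) else 0) +
        if D.defect s = 2 then (-1) ^ (D.numCircles s - 1) else 0) := by
  rw [topCoeff_eq]
  refine Finset.sum_congr rfl fun s _ => ?_
  have h0 := D.defect_nonneg s
  have h1 := D.numCircles_pos s
  rw [maxDegree]
  rw [defect] at h0 ⊢
  push_cast
  split_ifs with h h' h'
  · omega
  · rw [coeff_loop_value_pow_second (by omega)]
    push_cast [h1]
    ring
  · rw [coeff_loop_value_pow_top (by omega), zero_add]
  · rw [add_zero]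
    by_cases h1 : (D.numCircles allA : ℤ) + numB s - D.numCircles s = 1
    · exact coeff_loop_value_pow_of_odd (by omega)
    · exact coeff_loop_value_pow_of_lt (by omega)

end

section

/-! ### Cutting circles of the all-`A` state along a loop -/

/-- `S` is a union of circles of the all-`A` state, and the two arcs of the crossing `ℓ` cut it into
two parts, distinguished by `f`. -/
structure IsLoopCut (D : LinkDiagram X) (ℓ : X) (S : Set (X × Fin 4)) (f : X × Fin 4 → Prop) :
    Prop where
  glue_mem : ∀ d ∈ S, D.glue d ∈ S
  join_mem : ∀ x i, (x, i) ∈ S → (x, Smoothing.A.join i) ∈ S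
  mem_zero : (ℓ, 0) ∈ S
  mem_two : (ℓ, 2) ∈ S
  glue_iff : ∀ d ∈ S, (f (D.glue d) ↔ f d)
  join_iff : ∀ x i, x ≠ ℓ → (x, i) ∈ S → (f (x, Smoothing.A.join i) ↔ f (x, i))
  zero_iff : f (ℓ, 0) ↔ f (ℓ, 3)
  one_iff : f (ℓ, 1) ↔ f (ℓ, 2)
  ne : ¬ (f (ℓ, 0) ↔ f (ℓ, 1))

/-- Both arcs of `x` belong to `S`, or none. -/
def IsLevel (S : Set (X × Fin 4)) (x : X) : Prop := (x, 0) ∈ S ↔ (x, 2) ∈ S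

/-- No crossing with a `B`-resolution connects `S` to its complement. -/
def IsClean (S : Set (X × Fin 4)) (s : X → Smoothing) : Prop := ∀ x, s x = .B → IsLevel S x

/-- The crossing `ℓ` is not interlaced with any other crossing that has both its arcs in `S`. -/
def IsNoncrossing (ℓ : X) (S : Set (X × Fin 4)) (f : X × Fin 4 → Prop) : Prop :=
  ∀ z, z ≠ ℓ → (z, 0) ∈ S → (z, 2) ∈ S → (f (z, 0) ↔ f (z, 2))

theorem mem_one_iff {D : LinkDiagram X} {ℓ : X} {S : Set (X × Fin 4)} {f : X × Fin 4 → Prop}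
    (h : D.IsLoopCut ℓ S f) (x : X) : (x, 1) ∈ S ↔ (x, 0) ∈ S :=
  ⟨fun e => h.join_mem x 1 e, fun e => h.join_mem x 0 e⟩

theorem mem_three_iff {D : LinkDiagram X} {ℓ : X} {S : Set (X × Fin 4)} {f : X × Fin 4 → Prop}
    (h : D.IsLoopCut ℓ S f) (x : X) : (x, 3) ∈ S ↔ (x, 2) ∈ S :=
  ⟨fun e => h.join_mem x 3 e, fun e => h.join_mem x 2 e⟩

/-- A `B`-resolution at `ℓ` reconnects its ends within the two parts. At any other crossing a
`B`-resolution has either no arc in `S`, or two arcs in the same part because they are not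
interlaced with `ℓ`. -/
theorem IsLoopCut.isStateInvariant {D : LinkDiagram X} {ℓ : X} {S : Set (X × Fin 4)}
    {f : X × Fin 4 → Prop} (h : D.IsLoopCut ℓ S f) (hf : IsNoncrossing ℓ S f)
    {s : X → Smoothing} (hs : IsClean S s) (hℓ : s ℓ = .B) :
    D.IsStateInvariant s (fun d => d ∈ S ∧ f d) where
  glue d := by
    have : D.glue d ∈ S ↔ d ∈ S :=
      ⟨fun e => by simpa [D.glue_glue] using h.glue_mem _ e, h.glue_mem d⟩
    refine propext ?_
    rw [this]
    exact and_congr_right fun e => h.glue_iff d e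
  join x i := by
    refine propext ?_
    have m1 := mem_one_iff h x
    have m3 := mem_three_iff h x
    by_cases hx : x = ℓ
    · subst hx
      have := h.mem_zero
      have := h.mem_two
      have := h.zero_iff
      have := h.one_iff
      rw [hℓ]
      fin_cases i <;> simp_all [Smoothing.join]
    · have j := h.join_iff x
      rcases Smoothing.eq_A_or_eq_B (s x) with a | a
      · rw [a]
        have : (x, Smoothing.A.join i) ∈ S ↔ (x, i) ∈ S :=
          ⟨fun e => by simpa [join_join] using h.join_mem x _ e, h.join_mem x i⟩
        rw [this]
        exact and_congr_right fun e => j i hx e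
      · have c := hs x a
        have n := hf x hx
        rw [IsLevel] at c
        by_cases e : (x, 0) ∈ S
        · have j0 := j 0 hx e
          have j2 := j 2 hx (c.1 e)
          have n' := n e (c.1 e)
          have e2 := c.1 e
          rw [a]
          fin_cases i <;> simp_all [Smoothing.join]
        · have e2 : (x, 2) ∉ S := fun h => e (c.2 h)
          rw [a]
          fin_cases i <;> simp_all [Smoothing.join]

theorem IsLoopCut.mem_invariant {D : LinkDiagram X} {ℓ : X} {S : Set (X × Fin 4)}
    {f : X × Fin 4 → Prop} (h : D.IsLoopCut ℓ S f) {s : X → Smoothing}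
    (hs : ∀ x, s x = .B → (x, 0) ∉ S ∧ (x, 2) ∉ S) : D.IsStateInvariant s (· ∈ S) where
  glue d := propext ⟨fun e => by simpa [D.glue_glue] using h.glue_mem _ e, h.glue_mem d⟩
  join x i := by
    refine propext ?_
    have m1 := mem_one_iff h x
    have m3 := mem_three_iff h x
    rcases Smoothing.eq_A_or_eq_B (s x) with a | a
    · rw [a]
      fin_cases i <;> simp_all [Smoothing.join]
    · have := hs x a
      rw [a]
      fin_cases i <;> simp_all [Smoothing.join]

theorem IsLoopCut.isLevel {D : LinkDiagram X} {ℓ : X} {S : Set (X × Fin 4)}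
    {f : X × Fin 4 → Prop} (h : D.IsLoopCut ℓ S f) : IsLevel S ℓ := by
  simp [IsLevel, h.mem_zero, h.mem_two]

/-- Gaining or losing one circle reverses the sign of a state; positivity handles the truncated `-
1`. -/
theorem neg_one_pow_pred_of_add_sign {a b : ℕ} (ha : 0 < a) (hb : 0 < b) {σ : Smoothing}
    (h : (a : ℤ) = b + σ.sign) : (-1 : ℤ) ^ (a - 1) = -(-1) ^ (b - 1) := by
  obtain ⟨a, rfl⟩ := Nat.exists_eq_succ_of_ne_zero ha.ne'
  obtain ⟨b, rfl⟩ := Nat.exists_eq_succ_of_ne_zero hb.ne'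
  rcases Smoothing.eq_A_or_eq_B σ with rfl | rfl
  · have : a = b + 1 := by simp only [Smoothing.sign] at h; omega
    subst this
    simp [pow_succ]
  · have : b = a + 1 := by simp only [Smoothing.sign] at h; omega
    subst this
    simp [pow_succ]

/-- The other resolution. -/
def Smoothing.other : Smoothing → Smoothing
  | .A => .B
  | .B => .A

variable [DecidableEq X]

/-- The state `s` with the other resolution at `x`. -/
def toggle (x : X) (s : X → Smoothing) : X → Smoothing :=
  Function.update s x (Smoothing.other (s x))

theorem toggle_toggle (x : X) (s : X → Smoothing) : toggle x (toggle x s) = s := by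
  funext y
  by_cases hy : y = x
  · subst hy
    rcases Smoothing.eq_A_or_eq_B (s y) with h | h <;> simp [toggle, h, Smoothing.other]
  · simp [toggle, hy]

theorem toggle_involutive (x : X) : Function.Involutive (toggle x) := toggle_toggle x

theorem toggle_of_ne {x y : X} (h : y ≠ x) (s : X → Smoothing) : toggle x s y = s y :=
  Function.update_of_ne h _ _

theorem IsClean.toggle {S : Set (X × Fin 4)} {s : X → Smoothing} (h : IsClean S s) {x : X}
    (hx : IsLevel S x) : IsClean S (toggle x s) := by
  intro y hy
  by_cases hyx : y = x
  · rwa [hyx]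
  · exact h y (by rwa [toggle_of_ne hyx] at hy)

theorem isClean_toggle_iff {S : Set (X × Fin 4)} {s : X → Smoothing} {x : X}
    (hx : IsLevel S x) : IsClean S (LinkDiagram.toggle x s) ↔ IsClean S s :=
  ⟨fun h => by simpa [toggle_toggle] using h.toggle hx, fun h => h.toggle hx⟩

variable [Fintype X]

/-- With `B` at `ℓ`, the invariant `d ∈ S ∧ f d` separates the two arcs of `ℓ`, so going back to `A`
merges two circles. Circles and `B`-resolutions change by the same amount. -/
theorem IsLoopCut.numCircles_toggle {D : LinkDiagram X} {ℓ : X} {S : Set (X × Fin 4)}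
    {f : X × Fin 4 → Prop} (h : D.IsLoopCut ℓ S f) (hf : IsNoncrossing ℓ S f)
    {s : X → Smoothing} (hs : IsClean S s) :
    (D.numCircles (toggle ℓ s) : ℤ) = D.numCircles s + (s ℓ).sign ∧
      D.defect (toggle ℓ s) = D.defect s := by
  have main : ∀ t : X → Smoothing, IsClean S t → t ℓ = .A →
      (D.numCircles (toggle ℓ t) : ℤ) = D.numCircles t + 1 ∧
        D.defect (toggle ℓ t) = D.defect t := by
    intro t ht hℓ
    have e : toggle ℓ t = Function.update t ℓ .B := by rw [toggle, hℓ]; rfl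
    have hlev : IsLevel S ℓ := by simp [IsLevel, h.mem_zero, h.mem_two]
    have I := h.isStateInvariant hf (ht.toggle hlev) (by simp [e])
    have c := D.numCircles_of_invariant (s' := t) (x := ℓ)
      (fun y hy => (toggle_of_ne hy t).symm) (by simp [e, hℓ]) I (by
        simp [h.mem_zero, h.mem_two, ← h.one_iff, h.ne])
    refine ⟨by exact_mod_cast c, ?_⟩
    have b := numB_update hℓ
    rw [defect, defect, c, e, b]
    push_cast
    ring
  rcases Smoothing.eq_A_or_eq_B (s ℓ) with hℓ | hℓ
  · simpa [hℓ, Smoothing.sign] using main s hs hℓ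
  · have hlev : IsLevel S ℓ := by simp [IsLevel, h.mem_zero, h.mem_two]
    have := main _ (hs.toggle hlev) (by simp [toggle, hℓ, Smoothing.other])
    rw [toggle_toggle] at this
    refine ⟨?_, this.2.symm⟩
    rw [hℓ, Smoothing.sign, this.1]
    ring

theorem defect_update_of_invariant (D : LinkDiagram X) {s : X → Smoothing} {x : X}
    (hx : s x = .A) {β : Type*} {f : X × Fin 4 → β} (hf : D.IsStateInvariant s f)
    (h : f (x, 0) ≠ f (x, 2)) : D.defect (Function.update s x .B) = D.defect s + 2 := by
  have c := D.numCircles_of_invariant (s' := Function.update s x .B)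
    (fun y hy => Function.update_of_ne hy _ _) (by simp [hx]) hf h
  rw [defect, defect, numB_update hx]
  push_cast
  omega

/-- By monotonicity only one offending `B`-resolution needs to be kept. It merges a circle in `S`
with one outside: one `B` more and one circle less. -/
theorem IsLoopCut.two_le_defect {D : LinkDiagram X} {ℓ : X} {S : Set (X × Fin 4)}
    {f : X × Fin 4 → Prop} (h : D.IsLoopCut ℓ S f) {s : X → Smoothing} (hs : ¬ IsClean S s) :
    2 ≤ D.defect s := by
  simp only [IsClean, not_forall] at hs
  obtain ⟨z, hz, hl⟩ := hs
  have e : (fun x => if x ∈ Finset.univ.erase z then Smoothing.A else s x) =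
      Function.update allA z .B := by
    funext x
    by_cases hx : x = z
    · subst hx; simp [hz]
    · simp [hx, allA]
  have le := D.defect_reset_le s (Finset.univ.erase z)
  rw [e, D.defect_update_of_invariant rfl (h.mem_invariant (by simp [allA]))
    (fun e => hl (iff_of_eq e)), defect_allA] at le
  simpa using le

/-- An offending crossing for `S` does not touch `T`, so `T` remains a union of circles after it is
switched. The offending crossing for `T` then merges once more. -/
theorem IsLoopCut.four_le_defect {D : LinkDiagram X} {ℓ m : X} {S T : Set (X × Fin 4)}
    {f g : X × Fin 4 → Prop} (h : D.IsLoopCut ℓ S f) (k : D.IsLoopCut m T g)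
    (hST : ∀ z, (z, 0) ∈ S ∨ (z, 2) ∈ S → (z, 0) ∉ T ∧ (z, 2) ∉ T)
    {s : X → Smoothing} (hs : ¬ IsClean S s) (hs' : ¬ IsClean T s) : 4 ≤ D.defect s := by
  simp only [IsClean, not_forall] at hs hs'
  obtain ⟨z, hz, hl⟩ := hs
  obtain ⟨w, hw, hl'⟩ := hs'
  have hzT := hST z (by rw [IsLevel] at hl; tauto)
  have hwz : w ≠ z := by
    rintro rfl
    exact hl' (by simp [IsLevel, hzT.1, hzT.2])
  have e : (fun x => if x ∈ (Finset.univ.erase z).erase w then Smoothing.A else s x) =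
      Function.update (Function.update allA z .B) w .B := by
    funext x
    by_cases hx : x = w
    · subst hx; simp [hw]
    · by_cases hx' : x = z
      · subst hx'; simp [hz, hx]
      · simp [hx, hx', allA]
  have le := D.defect_reset_le s ((Finset.univ.erase z).erase w)
  have inv : D.IsStateInvariant (Function.update allA z .B) (· ∈ T) := by
    refine k.mem_invariant fun x hx => ?_
    by_cases hxz : x = z
    · rwa [hxz]
    · simp [hxz, allA] at hx
  rw [e, D.defect_update_of_invariant (by simp [hwz, allA]) inv (fun e => hl' (iff_of_eq e)),
    D.defect_update_of_invariant rfl (h.mem_invariant (by simp [allA]))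
    (fun e => hl (iff_of_eq e)), defect_allA] at le
  simpa using le

/-! ### Cancellation of the leading coefficients -/

/-- A loop of the all-`A` state graph that is not interlaced with any other loop makes the leading
coefficient vanish. -/
theorem IsLoopCut.topCoeff_zero {D : LinkDiagram X} {ℓ : X} {S : Set (X × Fin 4)}
    {f : X × Fin 4 → Prop} (h : D.IsLoopCut ℓ S f) (hf : IsNoncrossing ℓ S f) :
    D.topCoeff 0 = 0 := by
  have : Nonempty X := ⟨ℓ⟩
  rw [topCoeff_zero_eq]
  set w : (X → Smoothing) → ℤ := fun s =>
    if D.defect s = 0 then (-1) ^ (D.numCircles s - 1) else 0 with hw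
  have key : ∀ s, w (toggle ℓ s) = - w s := by
    intro s
    by_cases hs : IsClean S s
    · obtain ⟨c, d⟩ := h.numCircles_toggle hf hs
      have := neg_one_pow_pred_of_add_sign (D.numCircles_pos _) (D.numCircles_pos s) c
      simp only [hw, d, this]
      split_ifs <;> simp
    · have h1 := h.two_le_defect hs
      have h2 := h.two_le_defect ((isClean_toggle_iff h.isLevel).not.2 hs)
      simp only [hw]
      rw [if_neg (by omega), if_neg (by omega), neg_zero]
  have e : ∑ s, w (toggle ℓ s) = ∑ s, w s :=
    Equiv.sum_comp (toggle_involutive ℓ).toPerm w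
  simp only [key, Finset.sum_neg_distrib] at e
  change ∑ s, w s = 0
  omega

/-- Two loops on circles of the all-`A` state that are different and not adjacent, each of them not
interlaced with other loops, make the second coefficient vanish. -/
theorem IsLoopCut.topCoeff_one {D : LinkDiagram X} {ℓ m : X} {S T : Set (X × Fin 4)}
    {f g : X × Fin 4 → Prop} (h : D.IsLoopCut ℓ S f) (hf : IsNoncrossing ℓ S f)
    (k : D.IsLoopCut m T g) (hg : IsNoncrossing m T g)
    (hST : ∀ z, (z, 0) ∈ S ∨ (z, 2) ∈ S → (z, 0) ∉ T ∧ (z, 2) ∉ T) :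
    D.topCoeff 1 = 0 := by
  have : Nonempty X := ⟨ℓ⟩
  have hℓT := hST ℓ (Or.inl h.mem_zero)
  have hlm : ℓ ≠ m := by
    rintro rfl
    exact hℓT.1 k.mem_zero
  have levS : IsLevel S m := by
    have : ∀ P : (m, 0) ∈ S ∨ (m, 2) ∈ S, False := fun P => (hST m P).1 k.mem_zero
    rw [IsLevel]
    tauto
  have levT : IsLevel T ℓ := by simp [IsLevel, hℓT.1, hℓT.2]
  rw [topCoeff_one_eq, Finset.sum_add_distrib]
  set w₀ : (X → Smoothing) → ℤ := fun s =>
    if D.defect s = 0 then (-1) ^ (D.numCircles s - 1) * ((D.numCircles s : ℤ) - 1) else 0 with hw₀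
  set w₂ : (X → Smoothing) → ℤ := fun s =>
    if D.defect s = 2 then (-1) ^ (D.numCircles s - 1) else 0 with hw₂
  have cS : ∀ s, (IsClean S (toggle ℓ s) ↔ IsClean S s) ∧ (IsClean S (toggle m s) ↔ IsClean S s) :=
    fun s => ⟨isClean_toggle_iff h.isLevel, isClean_toggle_iff levS⟩
  have cT : ∀ s, (IsClean T (toggle ℓ s) ↔ IsClean T s) ∧ (IsClean T (toggle m s) ↔ IsClean T s) :=
    fun s => ⟨isClean_toggle_iff levT, isClean_toggle_iff k.isLevel⟩
  have flipS : ∀ s, IsClean S s → w₂ (toggle ℓ s) = - w₂ s := by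
    intro s hs
    obtain ⟨c, d⟩ := h.numCircles_toggle hf hs
    have := neg_one_pow_pred_of_add_sign (D.numCircles_pos _) (D.numCircles_pos s) c
    simp only [hw₂, d, this]
    split_ifs <;> simp
  have flipT : ∀ s, IsClean T s → w₂ (toggle m s) = - w₂ s := by
    intro s hs
    obtain ⟨c, d⟩ := k.numCircles_toggle hg hs
    have := neg_one_pow_pred_of_add_sign (D.numCircles_pos _) (D.numCircles_pos s) c
    simp only [hw₂, d, this]
    split_ifs <;> simp
  have comm : ∀ s, toggle m (toggle ℓ s) = toggle ℓ (toggle m s) := by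
    intro s
    simp only [toggle, Function.update_of_ne hlm, Function.update_of_ne hlm.symm]
    exact Function.update_comm hlm _ _ _
  -- On the orbit of both toggles, one toggle reverses signs as soon as its own circle is clean. If
  -- neither is clean, the defect is at least `4`, hence not `2`.
  have key₂ : ∀ s, w₂ s + w₂ (toggle ℓ s) + (w₂ (toggle m s) + w₂ (toggle ℓ (toggle m s))) = 0 := by
    intro s
    by_cases hs : IsClean S s
    · rw [flipS s hs, flipS (toggle m s) ((cS s).2.2 hs)]
      ring
    by_cases hs' : IsClean T s
    · rw [← comm, flipT s hs', flipT (toggle ℓ s) ((cT s).1.2 hs')]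
      ring
    have zero : ∀ t, ¬ IsClean S t → ¬ IsClean T t → w₂ t = 0 := by
      intro t h1 h2
      have := h.four_le_defect k hST h1 h2
      simp only [hw₂]
      rw [if_neg (by omega)]
    rw [zero, zero, zero, zero] <;> simp [cS, cT, hs, hs']
  -- If both are clean, the circle numbers on the orbit are `N`, `N + σ`, `N + τ`, `N + σ + τ`. The
  -- alternating sum is a second difference of the affine weight `N - 1`, so it vanishes.
  have key₀ : ∀ s, w₀ s + w₀ (toggle ℓ s) + (w₀ (toggle m s) + w₀ (toggle ℓ (toggle m s))) = 0 := by
    intro s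
    have zero : ∀ t, ¬ (IsClean S t ∧ IsClean T t) → w₀ t = 0 := by
      intro t ht
      have : 2 ≤ D.defect t := by
        by_cases h1 : IsClean S t
        · exact k.two_le_defect fun h2 => ht ⟨h1, h2⟩
        · exact h.two_le_defect h1
      simp only [hw₀]
      rw [if_neg (by omega)]
    by_cases hs : IsClean S s ∧ IsClean T s
    · obtain ⟨c1, d1⟩ := h.numCircles_toggle hf hs.1
      obtain ⟨c2, d2⟩ := k.numCircles_toggle hg hs.2
      obtain ⟨c3, d3⟩ := h.numCircles_toggle hf ((cS s).2.2 hs.1)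
      have e1 := neg_one_pow_pred_of_add_sign (D.numCircles_pos _) (D.numCircles_pos s) c1
      have e2 := neg_one_pow_pred_of_add_sign (D.numCircles_pos _) (D.numCircles_pos s) c2
      have e3 := neg_one_pow_pred_of_add_sign (D.numCircles_pos _) (D.numCircles_pos _) c3
      rw [toggle_of_ne hlm] at c3
      simp only [hw₀, d1, d2, d3]
      split_ifs
      · rw [e3, e2, e1, c3, c2, c1]
        ring
      · simp
    · rw [zero s hs, zero (toggle ℓ s), zero (toggle m s), zero (toggle ℓ (toggle m s))] <;>
        simp only [cS, cT, hs, not_false_iff, add_zero]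
  have quad : ∀ w : (X → Smoothing) → ℤ,
      (∀ s, w s + w (toggle ℓ s) + (w (toggle m s) + w (toggle ℓ (toggle m s))) = 0) →
      ∑ s, w s = 0 := by
    intro w hw
    have e1 : ∀ v : (X → Smoothing) → ℤ, ∑ s, v (toggle ℓ s) = ∑ s, v s :=
      Equiv.sum_comp (toggle_involutive ℓ).toPerm
    have e2 : ∀ v : (X → Smoothing) → ℤ, ∑ s, v (toggle m s) = ∑ s, v s :=
      Equiv.sum_comp (toggle_involutive m).toPerm
    have := Finset.sum_congr rfl fun s (_ : s ∈ Finset.univ) => hw s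
    simp only [Finset.sum_add_distrib, Finset.sum_const_zero] at this
    rw [e1 w, e2 w, e2 (fun s => w (toggle ℓ s)), e1 w] at this
    omega
  rw [quad w₀ key₀, quad w₂ key₂, add_zero]

end

/-! ### Planarity -/

/-- The face to the right of a half-edge that is directed away from its crossing. -/
def faceAt (D : LinkDiagram X) (d : X × Fin 4) : D.Face := Quot.mk _ d

theorem faceAt_surjective (D : LinkDiagram X) : Function.Surjective D.faceAt := Quot.mk_surjective

theorem faceAt_eq (D : LinkDiagram X) (d : X × Fin 4) :
    D.faceAt d = D.faceAt ((D.glue d).1, (D.glue d).2 + 1) :=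
  Quot.sound rfl

/-- `I` is constant on edges, and its sum around each crossing vanishes: a cycle modulo `2`. -/
structure IsCycleMod2 (D : LinkDiagram X) (I : X × Fin 4 → ZMod 2) : Prop where
  glue : ∀ d, I (D.glue d) = I d
  sum : ∀ x, ∑ i, I (x, i) = 0

instance [Finite X] (D : LinkDiagram X) : Finite D.Face :=
  Finite.of_surjective (Quot.mk _) Quot.mk_surjective

instance [Finite X] (D : LinkDiagram X) : Finite D.CrossingComponent :=
  Finite.of_surjective (Quot.mk _) Quot.mk_surjective

theorem const_of_isConnected [Finite X] [Nonempty X] {D : LinkDiagram X} (hconn : D.IsConnected)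
    {β : Type*} {f : X × Fin 4 → β} (h1 : ∀ d, f (D.glue d) = f d)
    (h2 : ∀ x i j, f (x, i) = f (x, j)) (d e : X × Fin 4) : f d = f e := by
  have : Nonempty D.CrossingComponent := ⟨Quot.mk _ (Classical.arbitrary X, 0)⟩
  have pos := Nat.card_pos (α := D.CrossingComponent)
  rw [IsConnected] at hconn
  have : Nat.card D.CrossingComponent = 1 := by omega
  have := (Nat.card_eq_one_iff_unique.1 this).1
  let F : D.CrossingComponent → β := Quot.lift f (by
    rintro ⟨a, j⟩ ⟨b, i⟩ (h | h)
    · rw [h, h1]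
    · obtain rfl : b = a := h
      exact h2 _ _ _)
  exact congrArg F (Subsingleton.elim (α := D.CrossingComponent) (Quot.mk _ d) (Quot.mk _ e))

theorem card_face [Fintype X] [Nonempty X] {D : LinkDiagram X} (hconn : D.IsConnected)
    (hplanar : D.IsPlanar) : Nat.card D.Face = Fintype.card X + 2 := by
  have : Nonempty D.CrossingComponent := ⟨Quot.mk _ (Classical.arbitrary X, 0)⟩
  have pos := Nat.card_pos (α := D.CrossingComponent)
  rw [IsConnected] at hconn
  rw [IsPlanar] at hplanar
  omega

/-! ### Cycles modulo `2` bound faces -/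

/-- A choice of one half-edge from each edge. -/
theorem exists_orientation (D : LinkDiagram X) : ∃ o : X × Fin 4 → Prop,
    ∀ d, o (D.glue d) ↔ ¬ o d := by
  classical
  let r : LinearOrder (X × Fin 4) := linearOrderOfSTO WellOrderingRel
  refine ⟨fun d => d < D.glue d, fun d => ?_⟩
  simp only [D.glue_glue, not_lt]
  exact ⟨le_of_lt, fun h => lt_of_le_of_ne h (D.glue_ne d)⟩

section

variable [Fintype X]

open Classical in
/-- The incidence matrix modulo `2` of the crossings and the edges, each edge represented by one
of its half-edges. -/
noncomputable def incidence (D : LinkDiagram X) (o : X × Fin 4 → Prop) :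
    Matrix {d // o d} X (ZMod 2) :=
  fun e x => (if e.1.1 = x then 1 else 0) + if (D.glue e.1).1 = x then 1 else 0

open Classical in
theorem card_orientation (D : LinkDiagram X) {o : X × Fin 4 → Prop}
    (ho : ∀ d, o (D.glue d) ↔ ¬ o d) : Fintype.card {d // o d} = 2 * Fintype.card X := by
  have e : {d // o d} ≃ {d // ¬ o d} :=
    { toFun := fun d => ⟨D.glue d, by simp [ho, d.2]⟩
      invFun := fun d => ⟨D.glue d, by simp [ho, d.2]⟩
      left_inv := fun d => by simp [D.glue_glue]
      right_inv := fun d => by simp [D.glue_glue] }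
  have h1 := Fintype.card_congr e
  have h2 := Fintype.card_subtype_compl o
  have h3 := Fintype.card_subtype_le o
  simp only [Fintype.card_prod, Fintype.card_fin] at h2 h3
  omega

open Classical in
theorem incidence_mulVec (D : LinkDiagram X) (o : X × Fin 4 → Prop) (u : X → ZMod 2)
    (e : {d // o d}) : (D.incidence o).mulVec u e = u e.1.1 + u (D.glue e.1).1 := by
  simp [Matrix.mulVec, dotProduct, incidence, add_mul, Finset.sum_add_distrib]

open Classical in
-- By connectedness only constants lie in the kernel of the incidence matrix, so its rank is at
-- least `|X| - 1`. There are `2|X|` edges, which leaves at most `|X| + 1` dimensions for the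
-- cycles.
theorem finrank_ker_incidence_transpose [Nonempty X] {D : LinkDiagram X} (hconn : D.IsConnected)
    {o : X × Fin 4 → Prop} (ho : ∀ d, o (D.glue d) ↔ ¬ o d) :
    Module.finrank (ZMod 2) (LinearMap.ker (D.incidence o).transpose.mulVecLin) ≤
      Fintype.card X + 1 := by
  have h1 : Module.finrank (ZMod 2) (LinearMap.ker (D.incidence o).mulVecLin) ≤ 1 := by
    refine finrank_le_one ⟨1, ?_⟩ ?_
    · ext e
      exact (D.incidence_mulVec o 1 e).trans (CharTwo.add_self_eq_zero 1)
    · rintro ⟨u, hu⟩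
      have hu' : ∀ e : {d // o d}, u e.1.1 + u (D.glue e.1).1 = 0 := by
        intro e
        rw [← incidence_mulVec]
        exact congrFun hu e
      have hu'' : ∀ d, u (D.glue d).1 = u d.1 := by
        intro d
        by_cases hd : o d
        · exact (CharTwo.add_eq_zero.1 (hu' ⟨d, hd⟩)).symm
        · have := hu' ⟨D.glue d, (ho d).2 hd⟩
          simp only [D.glue_glue] at this
          exact CharTwo.add_eq_zero.1 this
      have c := const_of_isConnected hconn (f := fun d => u d.1) hu'' (fun _ _ _ => rfl)
      refine ⟨u (Classical.arbitrary X), ?_⟩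
      ext x
      simpa using c (Classical.arbitrary X, 0) (x, 0)
  have h2 := LinearMap.finrank_range_add_finrank_ker (D.incidence o).mulVecLin
  have h3 := LinearMap.finrank_range_add_finrank_ker (D.incidence o).transpose.mulVecLin
  have h4 := Matrix.rank_transpose (D.incidence o)
  rw [Matrix.rank, Matrix.rank] at h4
  rw [Module.finrank_fintype_fun_eq_card] at h2 h3
  rw [D.card_orientation ho] at h3
  omega

/-- The edges between faces on which `g` takes different values. -/
def faceBoundary (D : LinkDiagram X) (o : X × Fin 4 → Prop) :
    (D.Face → ZMod 2) →ₗ[ZMod 2] ({d // o d} → ZMod 2) where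
  toFun g e := g (D.faceAt e.1) + g (D.faceAt (e.1.1, e.1.2 + 1))
  map_add' g h := by
    ext e
    simp only [Pi.add_apply]
    ring
  map_smul' c g := by
    ext e
    simp only [Pi.smul_apply, smul_eq_mul, RingHom.id_apply]
    ring

/-- In a planar diagram each cycle modulo `2` is the boundary of a set of faces. -/
theorem exists_face_coloring [Nonempty X] {D : LinkDiagram X} (hconn : D.IsConnected)
    (hplanar : D.IsPlanar) {I : X × Fin 4 → ZMod 2} (hI : D.IsCycleMod2 I) :
    ∃ g : X × Fin 4 → ZMod 2, (∀ d, g ((D.glue d).1, (D.glue d).2 + 1) = g d) ∧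
      ∀ x i, g (x, i + 1) = g (x, i) + I (x, i) := by
  classical
  obtain ⟨o, ho⟩ := D.exists_orientation
  have := Fintype.ofFinite D.Face
  -- the transpose of the incidence matrix sums over the half-edges at a crossing
  have vert : ∀ (J : X × Fin 4 → ZMod 2) (hJ : ∀ d, J (D.glue d) = J d) (x : X),
      (D.incidence o).transpose.mulVec (fun e => J e.1) x = ∑ i, J (x, i) := by
    intro J hJ x
    have e1 : (D.incidence o).transpose.mulVec (fun e => J e.1) x =
        ∑ e : {d // o d}, (if e.1.1 = x then J e.1 else 0) +
        ∑ e : {d // o d}, (if (D.glue e.1).1 = x then J e.1 else 0) := by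
      simp [Matrix.mulVec, dotProduct, incidence, add_mul, Finset.sum_add_distrib]
    have e2 : ∑ e : {d // o d}, (if (D.glue e.1).1 = x then J e.1 else 0) =
        ∑ e : {d // ¬ o d}, (if e.1.1 = x then J e.1 else 0) := by
      refine Fintype.sum_bijective (fun d => ⟨D.glue d, by simp [ho, d.2]⟩) ?_ _ _ ?_
      · refine Function.bijective_iff_has_inverse.2
          ⟨fun d => ⟨D.glue d, by simp [ho, d.2]⟩, fun d => ?_, fun d => ?_⟩ <;>
        simp [D.glue_glue]
      · intro d
        simp [hJ]
    rw [e1, e2, Fintype.sum_subtype_add_sum_subtype o (fun d => if d.1 = x then J d else 0),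
      Fintype.sum_prod_type, Finset.sum_eq_single x]
    · simp
    · intro y _ hy
      simp [hy]
    · simp
  have range_le : LinearMap.range (D.faceBoundary o) ≤
      LinearMap.ker (D.incidence o).transpose.mulVecLin := by
    rintro _ ⟨g, rfl⟩
    let J : X × Fin 4 → ZMod 2 := fun d => g (D.faceAt d) + g (D.faceAt (d.1, d.2 + 1))
    have hJ : ∀ d, J (D.glue d) = J d := by
      intro d
      have h1 := D.faceAt_eq d
      have h2 := D.faceAt_eq (D.glue d)
      rw [D.glue_glue] at h2
      simp only [J]
      rw [h2, ← h1, add_comm]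
    ext x
    refine (vert J hJ x).trans ?_
    simp only [J, Fin.sum_univ_four, Pi.zero_apply]
    simp only [Fin.isValue, show (0 : Fin 4) + 1 = 1 from rfl, show (1 : Fin 4) + 1 = 2 from rfl,
      show (2 : Fin 4) + 1 = 3 from rfl, show (3 : Fin 4) + 1 = 0 from rfl]
    ring_nf
    have two : (2 : ZMod 2) = 0 := by decide
    simp [two]
  have ker_le : Module.finrank (ZMod 2) (LinearMap.ker (D.faceBoundary o)) ≤ 1 := by
    refine finrank_le_one ⟨1, ?_⟩ ?_
    · ext e
      exact CharTwo.add_self_eq_zero 1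
    · rintro ⟨g, hg⟩
      have hg1 : ∀ d, o d → g (D.faceAt d) = g (D.faceAt (d.1, d.2 + 1)) := fun d hd =>
        CharTwo.add_eq_zero.1 (congrFun hg ⟨d, hd⟩)
      have hg2 : ∀ d, g (D.faceAt d) = g (D.faceAt (d.1, d.2 + 1)) := by
        intro d
        by_cases hd : o d
        · exact hg1 d hd
        · have := hg1 (D.glue d) ((ho d).2 hd)
          rw [← D.faceAt_eq, D.faceAt_eq (D.glue d), D.glue_glue] at this
          exact this.symm
      have hg3 : ∀ x i j, g (D.faceAt (x, i)) = g (D.faceAt (x, j)) := by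
        intro x i j
        have h0 := hg2 (x, 0)
        have h1 := hg2 (x, 1)
        have h2 := hg2 (x, 2)
        simp only [Fin.isValue, show (0 : Fin 4) + 1 = 1 from rfl,
          show (1 : Fin 4) + 1 = 2 from rfl, show (2 : Fin 4) + 1 = 3 from rfl] at h0 h1 h2
        have all : ∀ k : Fin 4, g (D.faceAt (x, k)) = g (D.faceAt (x, 0)) := by
          intro k
          fin_cases k
          · rfl
          · exact h0.symm
          · exact (h0.trans h1).symm
          · exact (h0.trans (h1.trans h2)).symm
        rw [all i, all j]
      have c := const_of_isConnected hconn (f := fun d => g (D.faceAt d))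
        (fun d => by
          rw [D.faceAt_eq d]
          exact hg3 _ _ _) hg3
      refine ⟨g (D.faceAt (Classical.arbitrary X, 0)), ?_⟩
      ext q
      obtain ⟨d, rfl⟩ := D.faceAt_surjective q
      simpa using c (Classical.arbitrary X, 0) d
  have rk := LinearMap.finrank_range_add_finrank_ker (D.faceBoundary o)
  rw [Module.finrank_fintype_fun_eq_card, ← Nat.card_eq_fintype_card,
    card_face hconn hplanar] at rk
  have k := finrank_ker_incidence_transpose hconn ho
  -- Euler's formula gives `|X| + 2` faces and only constants have zero boundary; so the boundaries
  -- have dimension at least `|X| + 1` and fill the cycle space.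
  have eq := Submodule.eq_of_le_of_finrank_le range_le (by omega)
  have mem : (fun e : {d // o d} => I e.1) ∈
      LinearMap.ker (D.incidence o).transpose.mulVecLin := by
    ext x
    exact (vert I hI.glue x).trans (hI.sum x)
  rw [← eq] at mem
  obtain ⟨g, hg⟩ := mem
  have hg1 : ∀ d, o d → g (D.faceAt d) + g (D.faceAt (d.1, d.2 + 1)) = I d := fun d hd =>
    congrFun hg ⟨d, hd⟩
  refine ⟨fun d => g (D.faceAt d), fun d => congrArg g (D.faceAt_eq d).symm, fun x i => ?_⟩
  have : g (D.faceAt (x, i)) + g (D.faceAt (x, i + 1)) = I (x, i) := by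
    by_cases hd : o (x, i)
    · exact hg1 _ hd
    · have := hg1 (D.glue (x, i)) ((ho _).2 hd)
      rw [← D.faceAt_eq, D.faceAt_eq (D.glue (x, i)), D.glue_glue, hI.glue] at this
      rw [add_comm]
      exact this
  rw [← this, ← add_assoc, CharTwo.add_self_eq_zero, zero_add]

end

/-! ### Checkerboard colorings and loops of planar diagrams -/

/-- `κ d` is the color of the face to the right of the half-edge `d`. -/
structure IsCheckerboard (D : LinkDiagram X) (κ : X × Fin 4 → ZMod 2) : Prop where
  glue : ∀ d, κ (D.glue d) = κ d + 1
  succ : ∀ x i, κ (x, i + 1) = κ (x, i) + 1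

theorem exists_isCheckerboard [Fintype X] [Nonempty X] {D : LinkDiagram X}
    (hconn : D.IsConnected) (hplanar : D.IsPlanar) : ∃ κ, D.IsCheckerboard κ := by
  -- All edges together form a cycle because every crossing has four ends.
  obtain ⟨g, h1, h2⟩ := exists_face_coloring hconn hplanar (I := fun _ => 1)
    ⟨fun _ => rfl, fun _ => by decide⟩
  refine ⟨g, fun d => ?_, h2⟩
  rw [← h1 d, h2, add_assoc, CharTwo.add_self_eq_zero, add_zero]

theorem ZMod.two_ne_iff (a b : ZMod 2) : a ≠ b ↔ a = b + 1 := by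
  revert a b; decide

namespace IsCheckerboard

variable {D : LinkDiagram X} {κ : X × Fin 4 → ZMod 2}

theorem one (hκ : D.IsCheckerboard κ) (x : X) : κ (x, 1) = κ (x, 0) + 1 := hκ.succ x 0

theorem two (hκ : D.IsCheckerboard κ) (x : X) : κ (x, 2) = κ (x, 0) := by
  rw [show (2 : Fin 4) = 1 + 1 from rfl, hκ.succ, hκ.one, add_assoc, CharTwo.add_self_eq_zero,
    add_zero]

theorem three (hκ : D.IsCheckerboard κ) (x : X) : κ (x, 3) = κ (x, 0) + 1 := by
  rw [show (3 : Fin 4) = 2 + 1 from rfl, hκ.succ, hκ.two]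

theorem join (hκ : D.IsCheckerboard κ) (x : X) (a : Smoothing) (i : Fin 4) : κ (x, a.join i) = κ (x, i) + 1 := by
  have h1 := hκ.one x
  have h2 := hκ.two x
  have h3 := hκ.three x
  have e : κ (x, 0) + 1 + 1 = κ (x, 0) := by rw [add_assoc, CharTwo.add_self_eq_zero, add_zero]
  cases a <;> fin_cases i <;> simp [Smoothing.join, h1, h2, h3, e]

end IsCheckerboard

/-- Go along the edge, then follow the arc of the state. -/
def advance (D : LinkDiagram X) (s : X → Smoothing) : Equiv.Perm (X × Fin 4) where
  toFun d := ((D.glue d).1, (s (D.glue d).1).join (D.glue d).2)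
  invFun d := D.glue (d.1, (s d.1).join d.2)
  left_inv d := by simp [join_join, D.glue_glue]
  right_inv d := by simp [join_join, D.glue_glue]

/-- A set `O` of half-edges of one color that is closed under `advance` yields an invariant
function. -/
theorem IsCheckerboard.isStateInvariant_of_advance {D : LinkDiagram X} {κ : X × Fin 4 → ZMod 2}
    (hκ : D.IsCheckerboard κ) (s : X → Smoothing) (c : ZMod 2) (O : X × Fin 4 → Prop)
    (hO : ∀ d, κ d = c → (O (D.advance s d) ↔ O d)) :
    D.IsStateInvariant s (fun d => (κ d = c → O d) ∧ (κ d ≠ c → O (D.glue d))) where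
  glue d := by
    refine propext ?_
    have := hκ.glue d
    rw [this, D.glue_glue]
    have e' : ∀ a b : ZMod 2, a + 1 = b ↔ a ≠ b := by decide
    rw [ne_eq, e']
    tauto
  join x i := by
    refine propext ?_
    have h1 := hκ.join x (s x) i
    have e' : ∀ a b : ZMod 2, a + 1 = b ↔ a ≠ b := by decide
    by_cases hd : κ (x, i) = c
    · have := hO (D.glue (x, (s x).join i)) (by
        rw [hκ.glue, h1, hd, add_assoc, CharTwo.add_self_eq_zero, add_zero])
      simp only [advance, Equiv.coe_fn_mk, D.glue_glue, join_join] at this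
      simp [h1, e', hd, this]
    · have := hO (D.glue (x, i)) (by rw [hκ.glue, e']; exact hd)
      simp only [advance, Equiv.coe_fn_mk, D.glue_glue] at this
      simp [h1, e', hd, this]

section

variable [DecidableEq X]

/-- The state with a `B`-resolution at `x` only. -/
def oneB (x : X) : X → Smoothing := Function.update allA x .B

/-- Changing the resolution at a loop of the all-`A` state splits the circle. -/
theorem IsCheckerboard.strandAt_oneB_ne [Finite X] {D : LinkDiagram X} {κ : X × Fin 4 → ZMod 2}
    (hκ : D.IsCheckerboard κ) {x : X} (hx : D.strandAt allA (x, 0) = D.strandAt allA (x, 2)) :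
    D.strandAt (oneB x) (x, 0) ≠ D.strandAt (oneB x) (x, 1) := by
  set ρ := D.advance allA with hρ
  have cyc : ρ.SameCycle (x, 0) (x, 2) := by
    have inv := hκ.isStateInvariant_of_advance allA (κ (x, 0)) (ρ.SameCycle (x, 0))
      (fun d _ => Equiv.Perm.sameCycle_apply_right)
    have := inv.eq_of_strandAt_eq hx
    simp only [hκ.two, ne_eq, not_true, false_implies, and_true, true_implies, eq_iff_iff] at this
    exact this.1 (Equiv.Perm.SameCycle.refl _ _)
  have ex : ∃ k : ℕ, (ρ ^ k) (x, 0) = (x, 2) := by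
    obtain ⟨k, _, hk⟩ := cyc.exists_pow_eq'
    exact ⟨k, hk⟩
  classical
  -- `k` is the first time at which the cycle of `(x, 0)` reaches `(x, 2)`; `O` below is the stretch
  -- of the cycle before that.
  set k := Nat.find ex with hk
  have kspec : (ρ ^ k) (x, 0) = (x, 2) := Nat.find_spec ex
  have kmin : ∀ i < k, (ρ ^ i) (x, 0) ≠ (x, 2) := fun i hi => Nat.find_min ex hi
  have kpos : 0 < k := by
    rcases Nat.eq_zero_or_pos k with h | h
    · rw [h] at kspec
      simp at kspec
    · exact h
  have noret : ∀ i, 0 < i → i < k → (ρ ^ i) (x, 0) ≠ (x, 0) := by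
    intro i h0 hi h
    refine kmin (k - i) (by omega) ?_
    rw [← kspec]
    conv_rhs => rw [show k = (k - i) + i by omega, pow_add, Equiv.Perm.mul_apply, h]
  let O : X × Fin 4 → Prop := fun d => ∃ i < k, (ρ ^ i) (x, 0) = d
  have hOb : ¬ O (x, 2) := fun ⟨i, hi, h⟩ => kmin i hi h
  have hOa : O (x, 0) := ⟨0, kpos, rfl⟩
  -- On this color, the new `advance` is the old one followed by the transposition of `(x, 0)` and
  -- `(x, 2)`. Both lie in one cycle, so the cycle splits, and `O` is one of the pieces.
  have adv : ∀ d, κ d = κ (x, 0) →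
      (ρ d = (x, 0) ∧ D.advance (oneB x) d = (x, 2)) ∨
      (ρ d = (x, 2) ∧ D.advance (oneB x) d = (x, 0)) ∨
      (ρ d ≠ (x, 0) ∧ ρ d ≠ (x, 2) ∧ D.advance (oneB x) d = ρ d) := by
    intro d hd
    have hg := hκ.glue d
    rw [hd] at hg
    have nosucc : κ (x, 0) ≠ κ (x, 0) + 1 := by
      generalize κ (x, 0) = a
      revert a
      decide
    simp only [hρ, advance, Equiv.coe_fn_mk]
    generalize D.glue d = e at hg ⊢
    obtain ⟨y, i⟩ := e
    by_cases hy : y = x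
    · subst hy
      have h2 := hκ.two y
      fin_cases i
      · exact (nosucc hg).elim
      · left; simp [allA, oneB, Smoothing.join]
      · exact (nosucc (h2.symm.trans hg)).elim
      · right; left; simp [allA, oneB, Smoothing.join]
    · right; right
      simp [allA, oneB, hy]
  have hO : ∀ d, κ d = κ (x, 0) → (O (D.advance (oneB x) d) ↔ O d) := by
    intro d hd
    have step : ∀ i, (ρ ^ (i + 1)) (x, 0) = ρ ((ρ ^ i) (x, 0)) := fun i => by
      rw [pow_succ', Equiv.Perm.mul_apply]
    rcases adv d hd with ⟨h1, h2⟩ | ⟨h1, h2⟩ | ⟨h1, h2, h3⟩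
    · rw [h2]
      refine iff_of_false hOb ?_
      rintro ⟨i, hi, rfl⟩
      rw [← step] at h1
      by_cases hik : i + 1 = k
      · rw [hik, kspec] at h1
        simp at h1
      · exact noret (i + 1) (by omega) (by omega) h1
    · rw [h2]
      refine iff_of_true hOa ⟨k - 1, by omega, ρ.injective ?_⟩
      rw [h1, ← step, show k - 1 + 1 = k by omega, kspec]
    · rw [h3]
      constructor
      · rintro ⟨i, hi, h⟩
        rcases i with _ | i
        · exact (h1 h.symm).elim
        · exact ⟨i, by omega, ρ.injective (by rw [← step, h])⟩
      · rintro ⟨i, hi, rfl⟩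
        by_cases hik : i + 1 = k
        · rw [← step, hik] at h2
          exact (h2 kspec).elim
        · exact ⟨i + 1, by omega, step i⟩
  have inv := hκ.isStateInvariant_of_advance (oneB x) (κ (x, 0)) O hO
  intro h
  have j := inv.join x 1
  have h' := inv.eq_of_strandAt_eq h
  rw [← j] at h'
  have hB : oneB x x = .B := by simp [oneB]
  simp only [hB, show Smoothing.B.join 1 = 2 from rfl, hκ.two, ne_eq, not_true, false_implies,
    and_true, true_implies, eq_iff_iff] at h'
  exact hOb (h'.1 hOa)

/-- The circle of the all-`A` state through a loop `x`, as the two circles into which it splits. -/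
def loopCircle (D : LinkDiagram X) (x : X) : Set (X × Fin 4) :=
  {d | D.strandAt (oneB x) d = D.strandAt (oneB x) (x, 0) ∨
    D.strandAt (oneB x) d = D.strandAt (oneB x) (x, 1)}

/-- One of the two parts into which the loop `x` cuts its circle. -/
def loopPart (D : LinkDiagram X) (x : X) (d : X × Fin 4) : Prop :=
  D.strandAt (oneB x) d = D.strandAt (oneB x) (x, 1)

theorem strandAt_oneB_join (D : LinkDiagram X) (x : X) :
    D.strandAt (oneB x) (x, 2) = D.strandAt (oneB x) (x, 1) ∧
      D.strandAt (oneB x) (x, 3) = D.strandAt (oneB x) (x, 0) := by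
  have j := (D.strandAt_invariant (oneB x)).join x
  have hB : oneB x x = .B := by simp [oneB]
  rw [hB] at j
  exact ⟨j 1, j 0⟩

theorem strandAt_oneB_join_of_ne (D : LinkDiagram X) {x y : X} (hy : y ≠ x) (i : Fin 4) :
    D.strandAt (oneB x) (y, Smoothing.A.join i) = D.strandAt (oneB x) (y, i) := by
  have j := (D.strandAt_invariant (oneB x)).join y i
  rwa [show oneB x y = .A by simp [oneB, hy, allA]] at j

theorem isLoopCut_of_strandAt_ne {D : LinkDiagram X} {x : X}
    (h : D.strandAt (oneB x) (x, 0) ≠ D.strandAt (oneB x) (x, 1)) :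
    D.IsLoopCut x (D.loopCircle x) (D.loopPart x) := by
  have I := D.strandAt_invariant (oneB x)
  obtain ⟨h2, h3⟩ := D.strandAt_oneB_join x
  refine ⟨?_, ?_, Or.inl rfl, Or.inr h2, ?_, ?_, ?_, ?_, ?_⟩
  · intro d hd
    simpa only [loopCircle, Set.mem_ofPred_eq, I.glue] using hd
  · intro y i hd
    by_cases hy : y = x
    · subst hy
      fin_cases i <;> simp [Smoothing.join, loopCircle, h2, h3]
    · simpa only [loopCircle, Set.mem_ofPred_eq, D.strandAt_oneB_join_of_ne hy] using hd
  · intro d _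
    rw [loopPart, loopPart, I.glue]
  · intro y i hy _
    rw [loopPart, loopPart, D.strandAt_oneB_join_of_ne hy]
  · rw [loopPart, loopPart, h3]
  · rw [loopPart, loopPart, h2]
  · simp [loopPart, h]

/-- This makes a crossing with both arcs on `loopCircle` a loop in its own right. -/
theorem strandAt_allA_eq_of_mem_loopCircle {D : LinkDiagram X} {x : X}
    (hx : D.strandAt allA (x, 0) = D.strandAt allA (x, 2)) {d : X × Fin 4}
    (hd : d ∈ D.loopCircle x) : D.strandAt allA d = D.strandAt allA (x, 0) := by
  have I : D.IsStateInvariant (oneB x) (D.strandAt allA) :=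
    D.strandAt_invariant_of_eq (x := x) (fun y hy => by simp [oneB, hy]) hx
  rcases hd with hd | hd
  · exact I.eq_of_strandAt_eq hd
  · rw [I.eq_of_strandAt_eq hd]
    exact (D.strandAt_invariant allA).join x 0

end

/-- In a planar diagram, two interlaced loops lie on different sides of their circle. -/
theorem IsCheckerboard.ne_of_interlaced [Fintype X] [DecidableEq X] {D : LinkDiagram X}
    {κ : X × Fin 4 → ZMod 2} (hκ : D.IsCheckerboard κ) (hconn : D.IsConnected)
    (hplanar : D.IsPlanar) {x y : X}
    (hx : D.strandAt (oneB x) (x, 0) ≠ D.strandAt (oneB x) (x, 1)) (hyx : y ≠ x)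
    (h0 : (y, 0) ∈ D.loopCircle x) (h2 : (y, 2) ∈ D.loopCircle x)
    (hy : ¬ (D.loopPart x (y, 0) ↔ D.loopPart x (y, 2))) : κ (y, 0) ≠ κ (x, 0) := by
  classical
  have : Nonempty X := ⟨x⟩
  have Inv := D.strandAt_invariant (oneB x)
  obtain ⟨x2, x3⟩ := D.strandAt_oneB_join x
  let J : X × Fin 4 → Prop := fun d => D.strandAt (oneB x) d = D.strandAt (oneB x) (x, 0)
  -- The part of the circle through `(x, 1)` is a cycle modulo `2`; the coloring `g` obtained from
  -- it distinguishes its two sides.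
  let I : X × Fin 4 → ZMod 2 := fun d => if D.loopPart x d then 1 else 0
  have Icongr : ∀ {d e}, D.strandAt (oneB x) d = D.strandAt (oneB x) e → I d = I e := by
    intro d e h
    have : D.loopPart x d ↔ D.loopPart x e := by rw [loopPart, loopPart, h]
    simp only [I, this]
  have Iglue : ∀ d, I (D.glue d) = I d := fun d => Icongr (Inv.glue d)
  have Ijoin : ∀ z i, z ≠ x → I (z, Smoothing.A.join i) = I (z, i) := fun z i hz =>
    Icongr (D.strandAt_oneB_join_of_ne hz i)
  have Jjoin : ∀ z i, z ≠ x → (J (z, Smoothing.A.join i) ↔ J (z, i)) := fun z i hz => by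
    simp only [J, D.strandAt_oneB_join_of_ne hz]
  have IJ : ∀ d, J d → I d = 0 := by
    intro d hd
    exact if_neg fun h => hx ((show D.strandAt (oneB x) d = _ from hd).symm.trans h)
  have Ix0 : I (x, 0) = 0 := IJ _ rfl
  have Ix3 : I (x, 3) = 0 := IJ _ x3
  have Ix1 : I (x, 1) = 1 := if_pos rfl
  have Ix2 : I (x, 2) = 1 := if_pos x2
  obtain ⟨g, g1, g2⟩ := exists_face_coloring hconn hplanar (I := I) (by
    refine ⟨Iglue, fun z => ?_⟩
    rw [Fin.sum_univ_four]
    by_cases hz : z = x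
    · subst hz
      rw [Ix0, Ix1, Ix2, Ix3]
      decide
    · have a := Ijoin z 0 hz
      have b := Ijoin z 2 hz
      simp only [Smoothing.join, Matrix.cons_val_zero, Matrix.cons_val] at a b
      rw [a, b, CharTwo.add_self_eq_zero, zero_add, CharTwo.add_self_eq_zero])
  have gglue : ∀ d, g (D.glue d) = g d + I d := by
    intro d
    rw [← g1 d, g2, ← Iglue d, add_assoc, CharTwo.add_self_eq_zero, add_zero]
  have g01 : ∀ z, g (z, 1) = g (z, 0) + I (z, 0) := fun z => g2 z 0
  have g12 : ∀ z, g (z, 2) = g (z, 1) + I (z, 1) := fun z => g2 z 1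
  have g23 : ∀ z, g (z, 3) = g (z, 2) + I (z, 2) := fun z => g2 z 2
  have g30 : ∀ z, g (z, 0) = g (z, 3) + I (z, 3) := fun z => g2 z 3
  -- Passing to the other side of an edge of the part flips both `g` and `κ`, so `g + κ` is constant
  -- along the part. The rest of the circle never crosses it, so `g` is constant there.
  have pair : ∀ {d e}, I e = I d → g e = g d + I d → κ e = κ d + 1 →
      I e * (g e + κ e) = I d * (g d + κ d) := by
    intro d e h1 h2 h3
    rw [h1, h2, h3]
    generalize I d = a, g d = b, κ d = c
    revert a b c
    decide
  have invPart : D.IsStateInvariant (oneB x) (fun d => I d * (g d + κ d)) := by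
    refine ⟨fun d => pair (Iglue d) (gglue d) (hκ.glue d), fun z i => ?_⟩
    by_cases hz : z = x
    · subst hz
      have e := pair (Ix2.trans Ix1.symm) (g12 z) (hκ.succ z 1)
      rw [show oneB z z = .B by simp [oneB]]
      fin_cases i
      · simp [Smoothing.join, Ix0, Ix3]
      · exact e
      · exact e.symm
      · simp [Smoothing.join, Ix0, Ix3]
    · have e0 := pair (Ijoin z 0 hz) (g01 z) (hκ.succ z 0)
      have e2 := pair (Ijoin z 2 hz) (g23 z) (hκ.succ z 2)
      rw [show oneB x z = .A by simp [oneB, hz, allA]]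
      fin_cases i
      · exact e0
      · exact e0.symm
      · exact e2
      · exact e2.symm
  have pair' : ∀ {d e}, (J e ↔ J d) → g e = g d + I d →
      (if J e then g e else 0) = if J d then g d else 0 := by
    intro d e h1 h2
    by_cases hd : J d
    · rw [if_pos hd, if_pos (h1.2 hd), h2, IJ d hd, add_zero]
    · rw [if_neg hd, if_neg (h1.not.2 hd)]
  have invRest : D.IsStateInvariant (oneB x) (fun d => if J d then g d else 0) := by
    refine ⟨fun d => pair' (by simp only [J, Inv.glue]) (gglue d), fun z i => ?_⟩
    by_cases hz : z = x
    · subst hz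
      have e := pair' (iff_of_true rfl x3) (g30 z)
      have n1 : ¬ J (z, 1) := fun h => hx (Eq.symm h)
      have n2 : ¬ J (z, 2) := fun h => n1 (x2.symm.trans h)
      rw [show oneB z z = .B by simp [oneB]]
      fin_cases i
      · exact e.symm
      · simp [Smoothing.join, n1, n2]
      · simp [Smoothing.join, n1, n2]
      · exact e
    · have e0 := pair' (Jjoin z 0 hz) (g01 z)
      have e2 := pair' (Jjoin z 2 hz) (g23 z)
      rw [show oneB x z = .A by simp [oneB, hz, allA]]
      fin_cases i
      · exact e0
      · exact e0.symm
      · exact e2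
      · exact e2.symm
  have onPart : ∀ d, D.loopPart x d → g d + κ d = g (x, 0) + (κ (x, 0) + 1) := by
    intro d hd
    have e := invPart.eq_of_strandAt_eq hd
    have Id : I d = 1 := if_pos hd
    simpa only [Id, Ix1, one_mul, g01 x, Ix0, add_zero, hκ.one] using e
  have onRest : ∀ d, J d → g d = g (x, 0) := by
    intro d hd
    have e := invRest.eq_of_strandAt_eq hd
    simpa only [if_pos hd, if_pos (show J (x, 0) from rfl)] using e
  rw [ZMod.two_ne_iff]
  -- At `y` one arc lies on the part and the other on the rest, so both formulas meet in a common
  -- value of `g`. The extra `1` in `onPart` arises because the half-edge of the part at `x` is `(x,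
  -- 1)`, of the color opposite to `(x, 0)`.
  by_cases hp : D.loopPart x (y, 0)
  · have J2 : J (y, 2) := h2.resolve_right fun h => hy (iff_of_true hp h)
    have e := onPart _ hp
    rw [g30 y, show I (y, 3) = 0 from (Ijoin y 2 hyx).trans (IJ _ J2), g23 y, IJ _ J2, onRest _ J2, add_zero,
      add_zero] at e
    exact add_left_cancel e
  · have J0 : J (y, 0) := h0.resolve_right hp
    have hp2 : D.loopPart x (y, 2) := by tauto
    have e := onPart _ hp2
    rw [g12 y, show I (y, 1) = 0 from (Ijoin y 0 hyx).trans (IJ _ J0), g01 y, IJ _ J0, onRest _ J0, add_zero,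
      add_zero, hκ.two] at e
    exact add_left_cancel e

/-! ### Loops in parallels -/

/-- In the all-`A` state of `D ^ n` the arcs in the grid of a crossing form `n` parallel copies of
each of the two arcs of `D`. To a half-edge of the grid corresponds one of the half-edges `1`, `2` of
`D`, which names the arc, and the number of the copy, counted from the center of the crossing. -/
def gridArc {n : ℕ} : (X × Fin n × Fin n) × Fin 4 → (X × Fin 4) × ℕ
  | ((z, j, k), 0) | ((z, j, k), 1) =>
    if (j : ℕ) ≤ k then ((z, 1), k - j) else ((z, 2), j - k - 1)
  | ((z, j, k), 2) | ((z, j, k), 3) =>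
    if (k : ℕ) ≤ j then ((z, 2), j - k) else ((z, 1), k - j - 1)

/-- The two half-edges with which the copies of the strands `0` and `3` next to the center of the
crossing enter the grid. -/
def IsCorner {n : ℕ} (h : (X × Fin n × Fin n) × Fin 4) : Prop :=
  (h.1.2.1 : ℕ) = 0 ∧ (h.1.2.2 : ℕ) = 0 ∧ (h.2 = 0 ∨ h.2 = 3)

/-- In the all-`A` state of `D ^ n`, the copy of the union `S` of circles of `D` that is outermost on
the side of the half-edges of color `c`. -/
def outermost (κ : X × Fin 4 → ZMod 2) (n : ℕ) (S : Set (X × Fin 4)) (c : ZMod 2) :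
    Set ((X × Fin n × Fin n) × Fin 4) :=
  {h | (gridArc h).1 ∈ S ∧ (gridArc h).2 = if κ (h.1.1, 0) = c then 0 else n - 1}

open Classical in
/-- The part of a circle of `D ^ n` that corresponds to a part of a circle of `D` cut at the
crossing `x`. -/
noncomputable def outermostPart (n : ℕ) (x : X) (f : X × Fin 4 → Prop)
    (h : (X × Fin n × Fin n) × Fin 4) : Prop :=
  if h.1.1 = x ∧ IsCorner h then f (x, 0) else f (gridArc h).1

theorem outer_or_interior (D : LinkDiagram X) {n : ℕ} (h : (X × Fin n × Fin n) × Fin 4) :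
    (∃ d p, h = outer d p) ∨
      (gridArc (D.parallelGlue n h) = gridArc h ∧ (D.parallelGlue n h).1.1 = h.1.1 ∧
        ¬ IsCorner h ∧ ¬ IsCorner (D.parallelGlue n h)) := by
  obtain ⟨⟨x, j, k⟩, i⟩ := h
  have hj := j.isLt
  have hk := k.isLt
  fin_cases i
  · by_cases h0 : (j : ℕ) = 0
    · exact Or.inl ⟨(x, 0), k, by simp [outer, Fin.ext_iff, h0]⟩
    · right
      simp [parallelGlue, h0, IsCorner, gridArc]
      split_ifs <;> simp <;> omega
  · by_cases h0 : (k : ℕ) + 1 = n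
    · refine Or.inl ⟨(x, 1), j, ?_⟩
      simp [outer, Fin.ext_iff, Fin.val_rev]
      omega
    · right
      simp [parallelGlue, h0, IsCorner, gridArc]
      split_ifs <;> simp <;> omega
  · by_cases h0 : (j : ℕ) + 1 = n
    · refine Or.inl ⟨(x, 2), Fin.rev k, ?_⟩
      simp [outer, Fin.ext_iff, Fin.val_rev]
      omega
    · right
      simp [parallelGlue, h0, IsCorner, gridArc]
      split_ifs <;> simp <;> omega
  · by_cases h0 : (k : ℕ) = 0
    · exact Or.inl ⟨(x, 3), Fin.rev j, by simp [outer, Fin.ext_iff, h0]⟩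
    · right
      simp [parallelGlue, h0, IsCorner, gridArc]
      split_ifs <;> simp <;> omega

theorem gridArc_outer_zero {n : ℕ} (z : X) (p : Fin n) :
    gridArc (outer (z, 0) p) = ((z, 1), (p : ℕ)) := by
  simp [outer, gridArc]

theorem gridArc_outer_one {n : ℕ} (z : X) (p : Fin n) :
    gridArc (outer (z, 1) p) = ((z, 1), n - 1 - (p : ℕ)) := by
  have := p.isLt
  simp [outer, gridArc, Fin.val_rev]
  omega

theorem gridArc_outer_two {n : ℕ} (z : X) (p : Fin n) :
    gridArc (outer (z, 2) p) = ((z, 2), (p : ℕ)) := by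
  have := p.isLt
  simp only [outer, gridArc, Fin.val_rev]
  rw [if_pos (by omega), show n - (0 + 1) - (n - (p + 1)) = (p : ℕ) by omega]

theorem gridArc_outer_three {n : ℕ} (z : X) (p : Fin n) :
    gridArc (outer (z, 3) p) = ((z, 2), n - 1 - (p : ℕ)) := by
  have := p.isLt
  simp [outer, gridArc, Fin.val_rev]
  omega

theorem fin_four_cases (i : Fin 4) : i = 0 ∨ i = 1 ∨ i = 2 ∨ i = 3 := by
  revert i; decide

theorem outer_fst {n : ℕ} (d : X × Fin 4) (p : Fin n) : (outer d p).1.1 = d.1 := by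
  obtain ⟨z, i⟩ := d
  fin_cases i <;> rfl

theorem gridArc_join {n : ℕ} (z : X × Fin n × Fin n) (i : Fin 4) :
    gridArc (z, Smoothing.A.join i) = gridArc (z, i) := by
  fin_cases i <;> rfl

section

variable {D : LinkDiagram X} {κ : X × Fin 4 → ZMod 2} {x : X} {S : Set (X × Fin 4)}
  {f : X × Fin 4 → Prop} {n : ℕ}

/-- The copy number equals `p` at the ends `0`, `2` and `n - 1 - p` at `1`, `3`, where the color
also flips. Expressed by position and by the color of `d` itself, the condition is the same at all
four ends and visibly survives the gluing, which reverses `p` and flips the color. -/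
theorem outer_mem_outermost (hκ : D.IsCheckerboard κ) (h : D.IsLoopCut x S f) (d : X × Fin 4)
    (p : Fin n) (c : ZMod 2) : outer d p ∈ outermost κ n S c ↔
      d ∈ S ∧ (p : ℕ) = if κ d = c then 0 else n - 1 := by
  obtain ⟨z, i⟩ := d
  have hp := p.isLt
  have m1 := mem_one_iff h z
  have m3 := mem_three_iff h z
  have e : ∀ a b : ZMod 2, a + 1 = b ↔ a ≠ b := by decide
  rw [outermost, Set.mem_ofPred_eq, outer_fst]
  obtain rfl | rfl | rfl | rfl := fin_four_cases i
  · rw [gridArc_outer_zero, m1]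
  · rw [gridArc_outer_one, hκ.one]
    simp only [e]
    refine and_congr_right fun _ => ?_
    split_ifs <;> first | contradiction | omega
  · rw [gridArc_outer_two, hκ.two]
  · rw [gridArc_outer_three, hκ.three]
    simp only [e, m3]
    refine and_congr_right fun _ => ?_
    split_ifs <;> first | contradiction | omega

/-- On this copy, the ends `0` and `3` of `x` enter the grid exactly at its corner half-edges, where
`outermostPart` takes the value at `(x, 0)`. The remainder of both arcs in the grid lies beyond the
cut and belongs to the part of `(x, 1)` and `(x, 2)`. -/
theorem outermostPart_outer (hκ : D.IsCheckerboard κ) (h : D.IsLoopCut x S f)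
    (d : X × Fin 4) (p : Fin n) (hd : outer d p ∈ outermost κ n S (κ (x, 0))) :
    outermostPart n x f (outer d p) ↔ f d := by
  rw [outer_mem_outermost hκ h] at hd
  obtain ⟨hd, hp⟩ := hd
  obtain ⟨z, i⟩ := d
  have e : ∀ a : ZMod 2, a + 1 ≠ a := by decide
  have hp' := p.isLt
  by_cases hz : z = x
  · subst hz
    rw [outermostPart, outer_fst]
    obtain rfl | rfl | rfl | rfl := fin_four_cases i
    · rw [if_pos]
      simpa [outer, IsCorner] using hp
    · rw [if_neg (by simp [outer, IsCorner]), gridArc_outer_one]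
    · rw [if_neg (by simp [outer, IsCorner]), gridArc_outer_two]
    · rw [if_pos]
      · exact h.zero_iff
      · rw [hκ.three, if_neg (e _)] at hp
        simp [outer, IsCorner, Fin.val_rev]
        omega
  · rw [outermostPart, outer_fst, if_neg (by simp [hz])]
    obtain rfl | rfl | rfl | rfl := fin_four_cases i
    · rw [gridArc_outer_zero]
      exact h.join_iff z 0 hz hd
    · rw [gridArc_outer_one]
    · rw [gridArc_outer_two]
    · rw [gridArc_outer_three]
      exact h.join_iff z 3 hz hd

/-- A loop of `D` gives a loop of `D ^ n`, on a circle that is outermost on the side of the loop. -/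
theorem IsLoopCut.parallel (h : D.IsLoopCut x S f) (hκ : D.IsCheckerboard κ) (hn : 1 < n) :
    (D.parallel n).IsLoopCut (x, ⟨0, by omega⟩, ⟨0, by omega⟩)
      (outermost κ n S (κ (x, 0))) (outermostPart n x f) := by
  have m1 := (mem_one_iff h x).2 h.mem_zero
  have glue_mem : ∀ d ∈ outermost κ n S (κ (x, 0)),
      D.parallelGlue n d ∈ outermost κ n S (κ (x, 0)) := by
    intro d hd
    rcases D.outer_or_interior d with ⟨d, p, rfl⟩ | ⟨h1, h2, -, -⟩
    · rw [outer_mem_outermost hκ h] at hd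
      rw [parallelGlue_outer, outer_mem_outermost hκ h]
      have e : ∀ a b : ZMod 2, a + 1 = b ↔ a ≠ b := by decide
      refine ⟨h.glue_mem _ hd.1, ?_⟩
      have hp := hd.2
      have hp' := p.isLt
      rw [hκ.glue, Fin.val_rev]
      simp only [e]
      split_ifs at hp ⊢ <;> first | contradiction | omega
    · rw [outermost, Set.mem_ofPred_eq, h1, h2]
      exact hd
  refine ⟨glue_mem, ?_, ?_, ?_, ?_, ?_, ?_, ?_, ?_⟩
  · intro z i hd
    rw [outermost, Set.mem_ofPred_eq, gridArc_join]
    exact hd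
  · simp [outermost, gridArc, m1]
  · simp [outermost, gridArc, h.mem_two]
  · intro d hd
    have hd' := glue_mem d hd
    change outermostPart n x f (D.parallelGlue n d) ↔ _
    rcases D.outer_or_interior d with ⟨d, p, rfl⟩ | ⟨h1, h2, h3, h4⟩
    · rw [outermostPart_outer hκ h d p hd]
      rw [parallelGlue_outer] at hd' ⊢
      rw [outermostPart_outer hκ h _ _ hd']
      exact h.glue_iff d ((outer_mem_outermost hκ h _ _ _).1 hd).1
    · rw [outermostPart, outermostPart, h1, if_neg fun e => h4 e.2, if_neg fun e => h3 e.2]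
  · rintro ⟨z, j, k⟩ i hz _
    have nc : ∀ i, ¬ (z = x ∧ IsCorner (((z, j, k), i) : (X × Fin n × Fin n) × Fin 4)) := by
      rintro i ⟨rfl, h1, h2, -⟩
      exact hz (by simp [Fin.ext_iff]; exact ⟨h1, h2⟩)
    rw [outermostPart, outermostPart, gridArc_join, if_neg (nc _), if_neg (nc _)]
  · simp [outermostPart, IsCorner]
  · simp [outermostPart, IsCorner, gridArc, h.one_iff]
  · simpa [outermostPart, IsCorner, gridArc] using h.ne

/-- Off the diagonal of a grid, both arcs of a crossing are copies of the same arc of `D`. On the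
diagonal they are the copies numbered `0`, which are outermost on the chosen side only if `z` has
the color of `x`. -/
theorem IsLoopCut.isNoncrossing_parallel (h : D.IsLoopCut x S f) (hn : 1 < n)
    (hf : ∀ z, z ≠ x → (z, 0) ∈ S → (z, 2) ∈ S → κ (z, 0) = κ (x, 0) → (f (z, 0) ↔ f (z, 2))) :
    IsNoncrossing (X := X × Fin n × Fin n) (x, ⟨0, by omega⟩, ⟨0, by omega⟩)
      (outermost κ n S (κ (x, 0))) (outermostPart n x f) := by
  rintro ⟨z, j, k⟩ hz h0 h2
  have nc : ∀ i, ¬ (z = x ∧ IsCorner (((z, j, k), i) : (X × Fin n × Fin n) × Fin 4)) := by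
    rintro i ⟨rfl, h1, h2, -⟩
    exact hz (by simp [Fin.ext_iff]; exact ⟨h1, h2⟩)
  rw [outermostPart, outermostPart, if_neg (nc _), if_neg (nc _)]
  simp only [outermost, Set.mem_ofPred_eq, gridArc] at h0 h2 ⊢
  rcases lt_trichotomy (j : ℕ) k with hjk | hjk | hjk
  · rw [if_pos hjk.le, if_neg (by omega)]
  · rw [if_pos hjk.le] at h0 ⊢
    rw [if_pos hjk.ge] at h2 ⊢
    by_cases hzx : z = x
    -- The other diagonal crossings of the grid of `x` have both arcs beyond the cut at the corner.
    · rw [hzx, h.one_iff]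
    · have c : κ (z, 0) = κ (x, 0) := by
        by_contra c
        rw [if_neg c] at h0
        have := h0.2
        omega
      have m := (mem_one_iff h z).1 h0.1
      rw [← hf z hzx m h2.1 c]
      exact h.join_iff z 0 hzx m
  · rw [if_neg (by omega), if_pos hjk.le]

/-- For `n ≥ 3`, no crossing of `D ^ n` connects copies that are outermost on different sides. -/
theorem not_adjacent_outermost {S T : Set (X × Fin 4)} {c c' : ZMod 2} (hc : c ≠ c') (hn : 2 < n)
    (z : X × Fin n × Fin n) (hz : (z, 0) ∈ outermost κ n S c ∨ (z, 2) ∈ outermost κ n S c) :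
    (z, 0) ∉ outermost κ n T c' ∧ (z, 2) ∉ outermost κ n T c' := by
  obtain ⟨z, j, k⟩ := z
  have two : ∀ a b c : ZMod 2, b ≠ c → (a = c ↔ a ≠ b) := by decide
  have e := two (κ (z, 0)) c c' hc
  -- The copy numbers of the two arcs at a crossing differ by at most `1`, but opposite sides would
  -- require `0` and `n - 1 ≥ 2`.
  have key : ∀ u v : ℕ, u ≤ v + 1 → v ≤ u + 1 →
      (u = if κ (z, 0) = c then 0 else n - 1) → (v = if κ (z, 0) = c' then 0 else n - 1) →
        False := by
    intro u v h1 h2 hu hv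
    simp only [e] at hv
    split_ifs at hu hv <;> first | contradiction | omega
  have close : (gridArc (((z, j, k), 0) : (X × Fin n × Fin n) × Fin 4)).2 ≤
      (gridArc (((z, j, k), 2) : (X × Fin n × Fin n) × Fin 4)).2 + 1 ∧
      (gridArc (((z, j, k), 2) : (X × Fin n × Fin n) × Fin 4)).2 ≤
      (gridArc (((z, j, k), 0) : (X × Fin n × Fin n) × Fin 4)).2 + 1 := by
    simp only [gridArc]
    split_ifs <;> constructor <;> dsimp only <;> omega
  simp only [outermost, Set.mem_ofPred_eq] at hz ⊢
  rcases hz with hz | hz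
  · exact ⟨fun h => key _ _ (by omega) (by omega) hz.2 h.2,
      fun h => key _ _ close.1 close.2 hz.2 h.2⟩
  · exact ⟨fun h => key _ _ close.2 close.1 hz.2 h.2,
      fun h => key _ _ (by omega) (by omega) hz.2 h.2⟩

end

/-- If the leading coefficient of `D` does not vanish, then each loop of the all-`A` state is
interlaced with a loop on the other side; so in a parallel with at least three strands there are loops
on non-adjacent circles. -/
theorem topCoeff_one_parallel {X : Type*} [Fintype X] [DecidableEq X] (D : LinkDiagram X)
    (hplanar : D.IsPlanar) (hconn : D.IsConnected)
    (hM : D.topCoeff 0 ≠ 0) (hA : ¬ D.IsAAdequate) (n : ℕ) (hn : 2 < n) :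
    (D.parallel n).topCoeff 1 = 0 := by
  simp only [IsAAdequate, not_forall, not_not] at hA
  obtain ⟨x, hx⟩ := hA
  have hx : D.strandAt allA (x, 0) = D.strandAt allA (x, 2) :=
    Sum.inl_injective (Sym2.mk_isDiag_iff.1 hx)
  have : Nonempty X := ⟨x⟩
  obtain ⟨κ, hκ⟩ := exists_isCheckerboard hconn hplanar
  have sx := hκ.strandAt_oneB_ne hx
  have cx := isLoopCut_of_strandAt_ne sx
  have crossing : ¬ IsNoncrossing x (D.loopCircle x) (D.loopPart x) := fun h =>
    hM (cx.topCoeff_zero h)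
  simp only [IsNoncrossing, not_forall] at crossing
  obtain ⟨y, hyx, y0, y2, hy⟩ := crossing
  have hκy := hκ.ne_of_interlaced hconn hplanar sx hyx y0 y2 hy
  -- Both arcs of `y` lie on the circle of `x`, so `y` is a loop as well.
  have sy := hκ.strandAt_oneB_ne ((strandAt_allA_eq_of_mem_loopCircle hx y0).trans
    (strandAt_allA_eq_of_mem_loopCircle hx y2).symm)
  have cy := isLoopCut_of_strandAt_ne sy
  have hn' : 1 < n := by omega
  refine (cx.parallel hκ hn').topCoeff_one
    (cx.isNoncrossing_parallel (κ := κ) hn' fun z hz z0 z2 e => ?_) (cy.parallel hκ hn')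
    (cy.isNoncrossing_parallel (κ := κ) hn' fun z hz z0 z2 e => ?_)
    (fun z => not_adjacent_outermost hκy.symm hn z)
  · by_contra c
    exact hκ.ne_of_interlaced hconn hplanar sx hz z0 z2 c e
  · by_contra c
    exact hκ.ne_of_interlaced hconn hplanar sy hz z0 z2 c e

end LinkDiagram

theorem lemma2p5 {X : Type*} [Fintype X] [DecidableEq X] (D : LinkDiagram X)
    (hplanar : D.IsPlanar) (hconn : D.IsConnected)
    (hM : D.topCoeff 0 ≠ 0) (hA : ¬ D.IsAAdequate) (n : ℕ) (hn : 2 < n) :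
    (D.parallel n).topCoeff 1 = 0 := by
  exact LinkDiagram.topCoeff_one_parallel D hplanar hconn hM hA n hn
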